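/- For a positive integer $n$ write $[n]=\{1,\dots,n\}$. For a linear equation $\mathcal E$ in $x,y,z$ and a $2$-coloring $\chi$ of $[n]$, let $\mu_\chi(\mathcal E,n)$ be the number of monochromatic solutions of $\mathcal E$ under $\chi$, that is, of ordered triples $(x,y,z)\in[n]^3$ that satisfy $\mathcal E$ and whose entries (not necessarily distinct) all have the same color. Let $M_{\mathcal E}(n)=\min_\chi \mu_\chi(\mathcal E,n)$, the minimum over all $2$-colorings $\chi$ of $[n]$, and let the Rado number $R_2(\mathcal E)$ be the least $N$ such that every $2$-coloring of $[N]$ has a monochromatic solution of $\mathcal E$. **Theorem.** Let $3\le a\le 7$ be an integer and let $\mathcal E$ be the equation $ax-ay=z$. 1. There is a constant $C$, depending only on $a$, such that for all $n\ge R_2(\mathcal E)$ $$M_{\mathcal E}(n)\;\ge\;\frac{(2a-1)n^2}{2a^4}-Cn .$$ 2. As $n\to\infty$, $$M_{\mathcal E}(n)=\frac{(2a-1)n^2}{2a^4}\,(1+o(1)).$$ 3. The coloring $\chi_a$ of $[n]$ that colors all multiples of $a$ red and all other integers blue is asymptotically optimal: $\mu_{\chi_a}(\mathcal E,n)=(1+o(1))\,M_{\mathcal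 E}(n)$ as $n\to\infty$. -/

import Mathlib

/-- The set of monochromatic solutions `(x, y, z) ∈ [n]³` of the equation `a x + b y = c z` under
the `k`-coloring `χ` of `[n] = {1, …, n}`. Solutions are ordered triples, and the variables may take
equal values. -/
def monoSolutions (a b c : ℤ) {n k : ℕ} (χ : Finset.Icc 1 n → Fin k) :
    Finset (Finset.Icc 1 n × Finset.Icc 1 n × Finset.Icc 1 n) :=
  Finset.univ.filter fun p =>
    a * (p.1 : ℕ) + b * (p.2.1 : ℕ) = c * (p.2.2 : ℕ) ∧ χ p.1 = χ p.2.1 ∧ χ p.2.1 = χ p.2.2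

/-- The number of monochromatic solutions of `a x + b y = c z` under the coloring `χ`. -/
def monoCount (a b c : ℤ) {n k : ℕ} (χ : Finset.Icc 1 n → Fin k) : ℕ :=
  (monoSolutions a b c χ).card

/-- The minimum number of monochromatic solutions of `a x + b y = c z` over all `k`-colorings of
`[n]` (an infimum in `ℕ` over a nonempty family as soon as `1 ≤ k`, hence attained). -/
noncomputable def minMonoCount (a b c : ℤ) (n k : ℕ) : ℕ :=
  ⨅ χ : Finset.Icc 1 n → Fin k, monoCount a b c χ

/-- The `k`-color Rado number of `a x + b y = c z`: the least `N` such that every `k`-coloring of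
`[N]` has a monochromatic solution. -/
noncomputable def radoNumber (a b c : ℤ) (k : ℕ) : ℕ :=
  sInf {N : ℕ | ∀ χ : Finset.Icc 1 N → Fin k, (monoSolutions a b c χ).Nonempty}

/-- The 2-coloring of `[n]` in which the multiples of `a` are red (`0`) and all other integers are
blue (`1`). -/
def multiplesColoring (a n : ℕ) : Finset.Icc 1 n → Fin 2 :=
  fun i => if a ∣ (i : ℕ) then 0 else 1

/-! Every solution is `(y + k, y, a * k)`: a pair at distance `k`, which must have the color of `a *
k`. Up to a linear error one may take n = a²l, so that `k` runs up to K = al. Let `r` be the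
indicator of red, relaxed to weights in [0, 1], and R its mass; exchanging the colors, assume R ≤
n/2. With `gap` the number of blue pairs minus red pairs at distance `k`, the count equals all red
pairs at distance at most K plus the sum of `gap` over those `k` for which `a * k` is blue
(`colorSum_eq`). Moreover `gap` is n - 2R - k plus the red mass of the first `k` and of the last `k`
points. For the coloring by multiples only pairs of multiples survive, about (2a - 1)l²/2 of them;
this is the value to be matched from below.

If red is sparse, every `gap` is so large that making a multiple of a blue gains at least as many
solutions as the red pairs of multiples it destroys (`colorSum_ge_of_sparse`).

If red is dense, cut [n] into a windows of length K. All pairs inside a window have distance below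
K, so convexity gives at least about R²/(2a) red pairs, against which stands only the negative part
of `gap` (`colorSum_ge_convex`). Near R = n/2 this yields (a - 4)K²/8, enough for a = 6, 7.
Averaging the formulas for the two colors gives a bound that is best for balanced colorings
(`colorSum_ge_symm`); it closes a = 5, and also a = 4 once `gap` is estimated from both ends of the
outer windows.

For a = 3 pairs in adjacent windows are needed too (`crossSum`). At moderate density, colorings with
few blue multiples of 3 are perturbations of the optimal one (`colorSum_three_perturb`); with many,
the blue multiples are charged to `gap` by the bathtub principle (`colorSum_three_ge_split`). At
high density a single value of `gap` controls both the loss from negative gaps and the gain from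
adjacent windows (`exists_gap_parameter`), unless the symmetric bound suffices
(`colorSum_three_symm`). What remains in each case is a quadratic inequality in a few real
variables. -/

namespace RadoCount

open Finset

/-! ### Sums of piecewise linear functions, and the bathtub principle. -/

/-- A sum over `(0, K]` of positive parts of `k - c`, up to `K / 2`. -/
theorem sum_ramp_bounds (c : ℝ) (K : ℕ) :
    |(∑ k ∈ Ioc 0 K, max 0 ((k : ℝ) - c)) - (max 0 ((K : ℝ) - c) ^ 2 / 2 - max 0 (-c) ^ 2 / 2)|
      ≤ (K : ℝ) / 2 := by
  induction K with
  | zero => simp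
  | succ K ih =>
    rw [Finset.sum_Ioc_succ_top (Nat.zero_le K)]
    push_cast
    rw [abs_le] at ih ⊢
    obtain ⟨h1, h2⟩ := ih
    rcases le_total ((K : ℝ) - c) 0 with h | h <;> rcases le_total ((K : ℝ) + 1 - c) 0 with h' | h'
    · rw [max_eq_left h] at h1 h2; rw [max_eq_left h']
      constructor <;> linarith
    · rw [max_eq_left h] at h1 h2; rw [max_eq_right h']
      constructor <;> nlinarith
    · linarith
    · rw [max_eq_right h] at h1 h2; rw [max_eq_right h']
      constructor <;> nlinarith

/-- A decreasing ramp on `(0, K]`. -/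
theorem sum_ramp_down_le (A : ℝ) (hA : 0 ≤ A) (K : ℕ) :
    ∑ k ∈ Ioc 0 K, max 0 (A - (k : ℝ)) ≤ A ^ 2 / 2 := by
  have key : ∀ K : ℕ, ∑ k ∈ Ioc 0 K, max 0 (A - (k : ℝ))
      ≤ A ^ 2 / 2 - max 0 (A - (K : ℝ)) ^ 2 / 2 := by
    intro K
    induction K with
    | zero => simp [max_eq_right hA]
    | succ K ih =>
      rw [Finset.sum_Ioc_succ_top (Nat.zero_le K)]
      push_cast
      rcases le_total (A - (K : ℝ)) 0 with h | h <;>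
        rcases le_total (A - ((K : ℝ) + 1)) 0 with h' | h'
      · rw [max_eq_left h] at ih; rw [max_eq_left h']; linarith
      · linarith
      · rw [max_eq_right h] at ih; rw [max_eq_left h']; nlinarith
      · rw [max_eq_right h] at ih; rw [max_eq_right h']; nlinarith
  have := key K
  nlinarith [sq_nonneg (max 0 (A - (K : ℝ)))]

/-- An increasing ramp at the right end of `(0, K]`. -/
theorem sum_ramp_up_le (A : ℝ) (hA : 0 ≤ A) (K : ℕ) :
    ∑ k ∈ Ioc 0 K, max 0 (A - ((K : ℝ) - k)) ≤ A ^ 2 / 2 + K / 2 := by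
  have h := (abs_le.1 (sum_ramp_bounds ((K : ℝ) - A) K)).2
  have e : ∀ k ∈ Ioc 0 K, max 0 (A - ((K : ℝ) - k)) = max 0 ((k : ℝ) - (K - A)) := by
    intro k _; congr 1; ring
  rw [Finset.sum_congr rfl e]
  have e2 : (K : ℝ) - (K - A) = A := by ring
  rw [e2, max_eq_right hA] at h
  nlinarith [sq_nonneg (max 0 (-((K : ℝ) - A)))]

theorem tent_eq_ramps (h x : ℝ) (hh : 0 ≤ h) :
    max 0 (h - |x|) = max 0 (x + h) - 2 * max 0 x + max 0 (x - h) := by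
  rcases le_total x 0 with hx | hx
  · rw [abs_of_nonpos hx, max_eq_left hx, max_eq_left (by linarith : x - h ≤ 0)]
    have : h - -x = x + h := by ring
    rw [this]; ring
  · rw [abs_of_nonneg hx, max_eq_right hx, max_eq_right (by linarith : 0 ≤ x + h)]
    rcases le_total (x - h) 0 with h1 | h1
    · rw [max_eq_left h1, max_eq_right (by linarith)]; ring
    · rw [max_eq_right h1, max_eq_left (by linarith)]; ring

/-- A sum of values of a tent of height `h` and slopes `±1`. -/
theorem sum_tent_le (c h : ℝ) (hh : 0 ≤ h) (K : ℕ) :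
    ∑ k ∈ Ioc 0 K, max 0 (h - |(k : ℝ) - c|) ≤ h ^ 2 + 2 * K := by
  have e : ∀ k ∈ Ioc 0 K, max 0 (h - |(k : ℝ) - c|) =
      max 0 ((k : ℝ) - (c - h)) - 2 * max 0 ((k : ℝ) - c) + max 0 ((k : ℝ) - (c + h)) := by
    intro k _
    rw [tent_eq_ramps h _ hh]
    congr 2
    · congr 1; ring
    · ring
  rw [Finset.sum_congr rfl e, Finset.sum_add_distrib, Finset.sum_sub_distrib, ← Finset.mul_sum]
  have h1 := abs_le.1 (sum_ramp_bounds (c - h) K)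
  have h2 := abs_le.1 (sum_ramp_bounds c K)
  have h3 := abs_le.1 (sum_ramp_bounds (c + h) K)
  -- This is the second difference, with step `h`, of half the squared positive part. That function
  -- has second derivative in [0, 1], so the difference lies between 0 and `h ^ 2`.
  have up : ∀ x : ℝ, max 0 (x + h) ^ 2 / 2 - max 0 x ^ 2 + max 0 (x - h) ^ 2 / 2 ≤ h ^ 2 := by
    intro x
    rcases le_total (x + h) 0 with a1 | a1
    · rw [max_eq_left a1, max_eq_left (by linarith : x ≤ 0), max_eq_left (by linarith : x - h ≤ 0)]
      nlinarith
    · rw [max_eq_right a1]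
      rcases le_total x 0 with a2 | a2
      · rw [max_eq_left a2, max_eq_left (by linarith : x - h ≤ 0)]; nlinarith
      · rw [max_eq_right a2]
        rcases le_total (x - h) 0 with a3 | a3
        · rw [max_eq_left a3]; nlinarith [sq_nonneg (x - h)]
        · rw [max_eq_right a3]; nlinarith
  have lo : ∀ x : ℝ, 0 ≤ max 0 (x + h) ^ 2 / 2 - max 0 x ^ 2 + max 0 (x - h) ^ 2 / 2 := by
    intro x
    rcases le_total x 0 with a2 | a2
    · rw [max_eq_left a2]; nlinarith [sq_nonneg (max 0 (x + h)), sq_nonneg (max 0 (x - h))]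
    · rw [max_eq_right a2, max_eq_right (by linarith : 0 ≤ x + h)]
      rcases le_total (x - h) 0 with a3 | a3
      · rw [max_eq_left a3]; nlinarith [sq_nonneg (x - h)]
      · rw [max_eq_right a3]; nlinarith
  have u := up ((K : ℝ) - c)
  have l := lo (-c)
  have e1 : (K : ℝ) - (c - h) = K - c + h := by ring
  have e2 : (K : ℝ) - (c + h) = K - c - h := by ring
  have e3 : -(c - h) = -c + h := by ring
  have e4 : -(c + h) = -c - h := by ring
  rw [e1, e3] at h1
  rw [e2, e4] at h3
  linarith [h1.2, h2.1, h3.2]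

/-- Lagrangian form of the bathtub principle. -/
theorem le_sum_weighted {ι : Type*} (s : Finset ι) (q f : ι → ℝ) (hq0 : ∀ i ∈ s, 0 ≤ q i)
    (hq1 : ∀ i ∈ s, q i ≤ 1) (θ : ℝ) :
    θ * ∑ i ∈ s, q i - ∑ i ∈ s, max 0 (θ - f i) ≤ ∑ i ∈ s, q i * f i := by
  rw [Finset.mul_sum, ← Finset.sum_sub_distrib]
  refine Finset.sum_le_sum fun i hi => ?_
  have h0 := hq0 i hi
  have h1 := hq1 i hi
  rcases le_total (θ - f i) 0 with h | h
  · rw [max_eq_left h]; nlinarith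
  · rw [max_eq_right h]; nlinarith

/-- Weights in `[0, 1]` of total mass `S` have first absolute moment at least about `S² / 4`. -/
theorem sum_weighted_abs_ge (q : ℕ → ℝ) (s : Finset ℕ) (K : ℕ) (hs : s ⊆ Ioc 0 K)
    (hq0 : ∀ i, 0 ≤ q i) (hq1 : ∀ i, q i ≤ 1) (c : ℝ) :
    (∑ i ∈ s, q i) ^ 2 / 4 - 2 * K ≤ ∑ i ∈ s, q i * |(i : ℝ) - c| := by
  set S := ∑ i ∈ s, q i with hS
  have hS0 : 0 ≤ S := Finset.sum_nonneg fun i _ => hq0 i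
  -- The level S/2 is optimal: the tent of that height has area S²/4, which leaves S²/2 - S²/4.
  have h := le_sum_weighted s q (fun i => |(i : ℝ) - c|) (fun i _ => hq0 i) (fun i _ => hq1 i) (S / 2)
  have h2 : ∑ i ∈ s, max 0 (S / 2 - |(i : ℝ) - c|) ≤ ∑ i ∈ Ioc 0 K, max 0 (S / 2 - |(i : ℝ) - c|) :=
    Finset.sum_le_sum_of_subset_of_nonneg hs fun i _ _ => le_max_left _ _
  have h3 := sum_tent_le c (S / 2) (by linarith) K
  rw [← hS] at h
  nlinarith

/-! ### Pairs at bounded distance, cut into windows. -/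

/-- Sum of `g` over the pairs `y < x` in `(0, n]` with `x - y ≤ K`. -/
noncomputable def pairSum (g : ℕ → ℕ → ℝ) (n K : ℕ) : ℝ :=
  ∑ k ∈ Ioc 0 K, ∑ y ∈ Ioc 0 (n - k), g y (y + k)

theorem pairSum_eq (g : ℕ → ℕ → ℝ) (n K : ℕ) :
    pairSum g n K =
      ∑ x ∈ Ioc 0 n, ∑ y ∈ Ioc 0 n, if y < x ∧ x ≤ y + K then g y x else 0 := by
  unfold pairSum
  simp_rw [← Finset.sum_filter]
  rw [Finset.sum_sigma', Finset.sum_sigma']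
  refine Finset.sum_nbij' (fun p => ⟨p.2 + p.1, p.2⟩) (fun p => ⟨p.1 - p.2, p.2⟩) ?_ ?_ ?_ ?_ ?_
  · rintro ⟨k, y⟩ h
    simp only [mem_sigma, mem_Ioc, mem_filter] at h ⊢
    omega
  · rintro ⟨x, y⟩ h
    simp only [mem_sigma, mem_Ioc, mem_filter] at h ⊢
    omega
  · rintro ⟨k, y⟩ h
    simp
  · rintro ⟨x, y⟩ h
    simp only [mem_sigma, mem_Ioc, mem_filter] at h
    have : y + (x - y) = x := by omega
    simp [this]
  · rintro ⟨k, y⟩ h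
    rfl

theorem sum_Ioc_mul (f : ℕ → ℝ) (a K : ℕ) :
    ∑ x ∈ Ioc 0 (a * K), f x = ∑ i ∈ range a, ∑ z ∈ Ioc 0 K, f (i * K + z) := by
  induction a with
  | zero => simp
  | succ a ih =>
    rw [Finset.sum_range_succ, ← ih, ← Finset.sum_Ioc_consecutive f (Nat.zero_le (a * K))
      (by nlinarith : a * K ≤ (a + 1) * K)]
    congr 1
    refine Finset.sum_nbij' (fun x => x - a * K) (fun z => a * K + z) ?_ ?_ ?_ ?_ ?_
    · intro x hx
      rw [mem_Ioc] at hx ⊢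
      have : (a + 1) * K = a * K + K := by ring
      omega
    · intro x hx
      rw [mem_Ioc] at hx ⊢
      have : (a + 1) * K = a * K + K := by ring
      omega
    · intro x hx
      rw [mem_Ioc] at hx
      omega
    · intro x hx
      omega
    · intro x hx
      rw [mem_Ioc] at hx
      congr 1
      omega

/-- The pairs inside a window. -/
theorem sum_lt_mul_eq (f : ℕ → ℝ) (K : ℕ) :
    ∑ z ∈ Ioc 0 K, ∑ z' ∈ Ioc 0 K, (if z' < z then f z' * f z else 0) =
      ((∑ z ∈ Ioc 0 K, f z) ^ 2 - ∑ z ∈ Ioc 0 K, f z ^ 2) / 2 := by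
  induction K with
  | zero => simp
  | succ K ih =>
    have h1 : ∀ z ∈ Ioc 0 K, ∑ z' ∈ Ioc 0 (K + 1), (if z' < z then f z' * f z else 0) =
        ∑ z' ∈ Ioc 0 K, (if z' < z then f z' * f z else 0) := by
      intro z hz
      rw [Finset.sum_Ioc_succ_top (Nat.zero_le K), if_neg, add_zero]
      rw [mem_Ioc] at hz; omega
    have h2 : ∑ z' ∈ Ioc 0 (K + 1), (if z' < K + 1 then f z' * f (K + 1) else 0) =
        (∑ z ∈ Ioc 0 K, f z) * f (K + 1) := by
      rw [Finset.sum_Ioc_succ_top (Nat.zero_le K), if_neg (lt_irrefl _), add_zero, Finset.sum_mul]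
      refine Finset.sum_congr rfl fun z hz => ?_
      rw [mem_Ioc] at hz
      rw [if_pos (by omega)]
    rw [Finset.sum_Ioc_succ_top (Nat.zero_le K), Finset.sum_congr rfl h1, h2, ih,
      Finset.sum_Ioc_succ_top (Nat.zero_le K), Finset.sum_Ioc_succ_top (Nat.zero_le K)]
    ring

/-- The window length equals the maximal distance, so within one window every pair counts, and
between adjacent windows exactly the pairs with `z ≤ z'` do. -/
theorem pairSum_windows (g : ℕ → ℕ → ℝ) (a K : ℕ) :
    pairSum g (a * K) K = ∑ i ∈ range a, ∑ j ∈ range a, ∑ z ∈ Ioc 0 K, ∑ z' ∈ Ioc 0 K,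
      if j * K + z' < i * K + z ∧ i * K + z ≤ j * K + z' + K
        then g (j * K + z') (i * K + z) else 0 := by
  rw [pairSum_eq]
  refine (sum_Ioc_mul _ a K).trans (Finset.sum_congr rfl fun i _ => ?_)
  exact (Finset.sum_congr rfl fun z _ => sum_Ioc_mul _ a K).trans Finset.sum_comm

theorem pairSum_ge_windows (g : ℕ → ℕ → ℝ) (hg : ∀ x y, 0 ≤ g x y) (a K : ℕ) :
    ∑ i ∈ range a, ∑ z ∈ Ioc 0 K, ∑ z' ∈ Ioc 0 K,
      (if z' < z then g (i * K + z') (i * K + z) else 0) ≤ pairSum g (a * K) K := by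
  rw [pairSum_windows]
  refine Finset.sum_le_sum fun i hi => ?_
  refine le_trans (le_of_eq ?_) (Finset.single_le_sum (f := fun j => ∑ z ∈ Ioc 0 K,
    ∑ z' ∈ Ioc 0 K, if j * K + z' < i * K + z ∧ i * K + z ≤ j * K + z' + K
        then g (j * K + z') (i * K + z) else 0) (fun j _ => ?_) hi)
  · refine Finset.sum_congr rfl fun z hz => Finset.sum_congr rfl fun z' hz' => ?_
    rw [mem_Ioc] at hz hz'
    by_cases h : z' < z
    · rw [if_pos h, if_pos (by omega)]
    · rw [if_neg h, if_neg (by omega)]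
  · refine Finset.sum_nonneg fun z _ => Finset.sum_nonneg fun z' _ => ?_
    split_ifs
    · exact hg _ _
    · exact le_rfl

/-- With three windows, the pairs in adjacent windows are kept as well. -/
theorem pairSum_three_ge (g : ℕ → ℕ → ℝ) (hg : ∀ x y, 0 ≤ g x y) (K : ℕ) :
    (∑ i ∈ range 3, ∑ z ∈ Ioc 0 K, ∑ z' ∈ Ioc 0 K,
      (if z' < z then g (i * K + z') (i * K + z) else 0)) +
      (∑ z ∈ Ioc 0 K, ∑ z' ∈ Ioc 0 K, if z ≤ z' then g z' (K + z) else 0) +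
      (∑ z ∈ Ioc 0 K, ∑ z' ∈ Ioc 0 K, if z ≤ z' then g (K + z') (2 * K + z) else 0)
      ≤ pairSum g (3 * K) K := by
  rw [pairSum_windows]
  have nn : ∀ i j : ℕ, 0 ≤ ∑ z ∈ Ioc 0 K, ∑ z' ∈ Ioc 0 K,
      if j * K + z' < i * K + z ∧ i * K + z ≤ j * K + z' + K
        then g (j * K + z') (i * K + z) else 0 := by
    intro i j
    refine Finset.sum_nonneg fun z _ => Finset.sum_nonneg fun z' _ => ?_
    split_ifs
    · exact hg _ _
    · exact le_rfl
  have dg : ∀ i : ℕ, (∑ z ∈ Ioc 0 K, ∑ z' ∈ Ioc 0 K,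
      if z' < z then g (i * K + z') (i * K + z) else 0) = ∑ z ∈ Ioc 0 K, ∑ z' ∈ Ioc 0 K,
      if i * K + z' < i * K + z ∧ i * K + z ≤ i * K + z' + K
        then g (i * K + z') (i * K + z) else 0 := by
    intro i
    refine Finset.sum_congr rfl fun z hz => Finset.sum_congr rfl fun z' hz' => ?_
    rw [mem_Ioc] at hz hz'
    by_cases h : z' < z
    · rw [if_pos h, if_pos (by omega)]
    · rw [if_neg h, if_neg (by omega)]
  have c01 : (∑ z ∈ Ioc 0 K, ∑ z' ∈ Ioc 0 K, if z ≤ z' then g z' (K + z) else 0) =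
      ∑ z ∈ Ioc 0 K, ∑ z' ∈ Ioc 0 K,
      if 0 * K + z' < 1 * K + z ∧ 1 * K + z ≤ 0 * K + z' + K
        then g (0 * K + z') (1 * K + z) else 0 := by
    refine Finset.sum_congr rfl fun z hz => Finset.sum_congr rfl fun z' hz' => ?_
    rw [mem_Ioc] at hz hz'
    simp only [zero_mul, zero_add, one_mul]
    by_cases h : z ≤ z'
    · rw [if_pos h, if_pos (by omega)]
    · rw [if_neg h, if_neg (by omega)]
  have c12 : (∑ z ∈ Ioc 0 K, ∑ z' ∈ Ioc 0 K, if z ≤ z' then g (K + z') (2 * K + z) else 0) =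
      ∑ z ∈ Ioc 0 K, ∑ z' ∈ Ioc 0 K,
      if 1 * K + z' < 2 * K + z ∧ 2 * K + z ≤ 1 * K + z' + K
        then g (1 * K + z') (2 * K + z) else 0 := by
    refine Finset.sum_congr rfl fun z hz => Finset.sum_congr rfl fun z' hz' => ?_
    rw [mem_Ioc] at hz hz'
    simp only [one_mul]
    by_cases h : z ≤ z'
    · rw [if_pos h, if_pos (by omega)]
    · rw [if_neg h, if_neg (by omega)]
  rw [c01, c12]
  simp only [Finset.sum_range_succ, Finset.sum_range_zero, dg]
  have := nn 0 1
  have := nn 0 2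
  have := nn 1 2
  have := nn 2 0
  linarith

/-! ### Masses, the gap, and the weighted count of solutions. -/

/-- Total mass of the weight `r` on `(0, n]`. -/
noncomputable def mass (r : ℕ → ℝ) (n : ℕ) : ℝ := ∑ i ∈ Ioc 0 n, r i

/-- Mass of the weight `r` on the window `(iK, (i+1)K]`. -/
noncomputable def winMass (r : ℕ → ℝ) (K i : ℕ) : ℝ := ∑ z ∈ Ioc 0 K, r (i * K + z)

/-- The weighted number of monochromatic solutions `(y + k, y, a k)` with `k ≤ K`, where `r` is the
indicator function of the first color. -/
noncomputable def colorSum (r : ℕ → ℝ) (a n K : ℕ) : ℝ :=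
  ∑ k ∈ Ioc 0 K, ∑ y ∈ Ioc 0 (n - k),
    (r (a * k) * (r y * r (y + k)) + (1 - r (a * k)) * ((1 - r y) * (1 - r (y + k))))

/-- The number of pairs at distance `k` in the second color minus that in the first color. -/
noncomputable def gap (r : ℕ → ℝ) (n k : ℕ) : ℝ :=
  (n : ℝ) - k - 2 * mass r n + mass r k + (mass r n - mass r (n - k))

theorem mass_sub (r : ℕ → ℝ) {m n : ℕ} (h : m ≤ n) :
    mass r n - mass r m = ∑ i ∈ Ioc m n, r i := by
  unfold mass
  rw [← Finset.sum_Ioc_consecutive r (Nat.zero_le m) h]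
  ring

theorem mass_mono {r : ℕ → ℝ} (h0 : ∀ i, 0 ≤ r i) {m n : ℕ} (h : m ≤ n) :
    mass r m ≤ mass r n := by
  have := mass_sub r h
  have : 0 ≤ ∑ i ∈ Ioc m n, r i := Finset.sum_nonneg fun i _ => h0 i
  linarith

theorem mass_nonneg {r : ℕ → ℝ} (h0 : ∀ i, 0 ≤ r i) (n : ℕ) : 0 ≤ mass r n :=
  Finset.sum_nonneg fun i _ => h0 i

theorem mass_sub_le {r : ℕ → ℝ} (h1 : ∀ i, r i ≤ 1) {m n : ℕ} (h : m ≤ n) :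
    mass r n - mass r m ≤ (n : ℝ) - m := by
  rw [mass_sub r h]
  refine (Finset.sum_le_sum fun i _ => h1 i).trans ?_
  rw [Finset.sum_const, Nat.card_Ioc, nsmul_eq_mul, mul_one, Nat.cast_sub h]

theorem mass_le {r : ℕ → ℝ} (h1 : ∀ i, r i ≤ 1) (n : ℕ) : mass r n ≤ n := by
  have := mass_sub_le h1 (Nat.zero_le n)
  simpa [mass] using this

theorem mass_compl (r : ℕ → ℝ) (n : ℕ) : mass (fun i => 1 - r i) n = n - mass r n := by
  simp [mass, Finset.sum_sub_distrib]

theorem sum_shift (r : ℕ → ℝ) {k n : ℕ} (h : k ≤ n) :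
    ∑ y ∈ Ioc 0 (n - k), r (y + k) = mass r n - mass r k := by
  rw [mass_sub r h]
  refine Finset.sum_nbij' (fun y => y + k) (fun y => y - k) ?_ ?_ ?_ ?_ ?_
  · intro y hy; rw [mem_Ioc] at hy ⊢; omega
  · intro y hy; rw [mem_Ioc] at hy ⊢; omega
  · intro y hy; omega
  · intro y hy; rw [mem_Ioc] at hy; omega
  · intro y hy; rfl

theorem gap_compl (r : ℕ → ℝ) {n k : ℕ} (h : k ≤ n) :
    gap (fun i => 1 - r i) n k = -gap r n k := by
  unfold gap
  rw [mass_compl, mass_compl, mass_compl, Nat.cast_sub h]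
  ring

/-- The weighted number of monochromatic solutions through the pairs of the first color. -/
theorem colorSum_eq (r : ℕ → ℝ) (a n K : ℕ) (hK : K ≤ n) :
    colorSum r a n K = pairSum (fun x y => r x * r y) n K +
      ∑ k ∈ Ioc 0 K, (1 - r (a * k)) * gap r n k := by
  unfold colorSum pairSum
  rw [← Finset.sum_add_distrib]
  refine Finset.sum_congr rfl fun k hk => ?_
  rw [mem_Ioc] at hk
  have hkn : k ≤ n := by omega
  have e : ∀ y ∈ Ioc 0 (n - k),
      (r (a * k) * (r y * r (y + k)) + (1 - r (a * k)) * ((1 - r y) * (1 - r (y + k)))) =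
      r y * r (y + k) + (1 - r (a * k)) * (1 - r y - r (y + k)) := fun y _ => by ring
  rw [Finset.sum_congr rfl e, Finset.sum_add_distrib, ← Finset.mul_sum, Finset.sum_sub_distrib,
    Finset.sum_sub_distrib, sum_shift r hkn]
  congr 2
  simp only [Finset.sum_const, Nat.card_Ioc, nsmul_eq_mul, mul_one, Nat.sub_zero]
  rw [Nat.cast_sub hkn]
  unfold gap mass
  ring

theorem colorSum_compl (r : ℕ → ℝ) (a n K : ℕ) :
    colorSum (fun i => 1 - r i) a n K = colorSum r a n K := by
  unfold colorSum
  refine Finset.sum_congr rfl fun k _ => Finset.sum_congr rfl fun y _ => ?_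
  ring

/-- The lower bound that is symmetric in the colors. -/
theorem colorSum_ge_symm (r : ℕ → ℝ) (h0 : ∀ i, 0 ≤ r i) (h1 : ∀ i, r i ≤ 1) (a n K : ℕ)
    (hK : K ≤ n) :
    (pairSum (fun x y => r x * r y) n K + pairSum (fun x y => (1 - r x) * (1 - r y)) n K -
      ∑ k ∈ Ioc 0 K, |gap r n k|) / 2 ≤ colorSum r a n K := by
  have e1 := colorSum_eq r a n K hK
  have e2 := colorSum_eq (fun i => 1 - r i) a n K hK
  rw [colorSum_compl] at e2
  -- Exchanging the colors negates `gap` and replaces the weight 1 - r by r, so in the sum of the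
  -- two formulas `gap` has the coefficient 1 - 2r, of absolute value at most 1.
  have e3 : -∑ k ∈ Ioc 0 K, |gap r n k| ≤ ∑ k ∈ Ioc 0 K, (1 - r (a * k)) * gap r n k +
      ∑ k ∈ Ioc 0 K, (1 - (1 - r (a * k))) * gap (fun i => 1 - r i) n k := by
    rw [← Finset.sum_add_distrib, ← Finset.sum_neg_distrib]
    refine Finset.sum_le_sum fun k hk => ?_
    rw [mem_Ioc] at hk
    rw [gap_compl r (by omega)]
    have ha := h0 (a * k)
    have hb := h1 (a * k)
    rcases abs_cases (gap r n k) with ⟨h, h'⟩ | ⟨h, h'⟩ <;> rw [h] <;> nlinarith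
  linarith

theorem winMass_nonneg {r : ℕ → ℝ} (h0 : ∀ i, 0 ≤ r i) (K i : ℕ) : 0 ≤ winMass r K i :=
  Finset.sum_nonneg fun _ _ => h0 _

theorem winMass_le {r : ℕ → ℝ} (h1 : ∀ i, r i ≤ 1) (K i : ℕ) : winMass r K i ≤ K := by
  refine (Finset.sum_le_sum fun z _ => h1 _).trans ?_
  simp

theorem winMass_compl (r : ℕ → ℝ) (K i : ℕ) :
    winMass (fun i => 1 - r i) K i = K - winMass r K i := by
  simp [winMass, Finset.sum_sub_distrib]

theorem mass_mul (r : ℕ → ℝ) (a K : ℕ) : mass r (a * K) = ∑ i ∈ range a, winMass r K i :=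
  sum_Ioc_mul r a K

/-- Pairs inside the windows. -/
theorem pairSum_ge_sq (r : ℕ → ℝ) (h0 : ∀ i, 0 ≤ r i) (h1 : ∀ i, r i ≤ 1) (a K : ℕ) :
    (∑ i ∈ range a, winMass r K i ^ 2) / 2 - a * K / 2 ≤
      pairSum (fun x y => r x * r y) (a * K) K := by
  refine le_trans ?_ (pairSum_ge_windows _ (fun x y => mul_nonneg (h0 x) (h0 y)) a K)
  have e : ∀ i ∈ range a, winMass r K i ^ 2 / 2 - K / 2 ≤ ∑ z ∈ Ioc 0 K, ∑ z' ∈ Ioc 0 K,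
      (if z' < z then r (i * K + z') * r (i * K + z) else 0) := by
    intro i _
    rw [sum_lt_mul_eq (fun z => r (i * K + z)) K]
    have : ∑ z ∈ Ioc 0 K, r (i * K + z) ^ 2 ≤ K := by
      refine (Finset.sum_le_sum fun z _ => pow_le_one₀ (h0 _) (h1 _)).trans ?_
      simp
    unfold winMass
    linarith
  refine le_trans (le_of_eq ?_) (Finset.sum_le_sum e)
  rw [Finset.sum_sub_distrib, ← Finset.sum_div, Finset.sum_const, card_range, nsmul_eq_mul]
  ring

/-! ### Pairs of multiples of `a`, and sparse first color. -/

theorem sum_dilate_le (f : ℕ → ℝ) (hf : ∀ x, 0 ≤ f x) (a m : ℕ) (ha : 0 < a) :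
    ∑ x ∈ Ioc 0 m, f (a * x) ≤ ∑ x ∈ Ioc 0 (a * m), f x := by
  rw [← Finset.sum_image (s := Ioc 0 m) (g := fun x => a * x) (f := f)]
  · refine Finset.sum_le_sum_of_subset_of_nonneg ?_ fun x _ _ => hf x
    intro x hx
    rw [mem_image] at hx
    obtain ⟨y, hy, rfl⟩ := hx
    rw [mem_Ioc] at hy ⊢
    exact ⟨Nat.mul_pos ha hy.1, Nat.mul_le_mul_left a hy.2⟩
  · intro x _ y _ h
    exact Nat.eq_of_mul_eq_mul_left ha h

theorem pairSum_dilate_le (g : ℕ → ℕ → ℝ) (hg : ∀ x y, 0 ≤ g x y) (a m l : ℕ) (ha : 0 < a) :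
    pairSum (fun x y => g (a * x) (a * y)) m l ≤ pairSum g (a * m) (a * l) := by
  rw [pairSum_eq, pairSum_eq]
  have nn : ∀ x y : ℕ, 0 ≤ if y < x ∧ x ≤ y + a * l then g y x else 0 := by
    intro x y
    split_ifs
    · exact hg _ _
    · exact le_rfl
  refine le_trans ?_ (sum_dilate_le (fun x => ∑ y ∈ Ioc 0 (a * m),
    if y < x ∧ x ≤ y + a * l then g y x else 0) (fun x => Finset.sum_nonneg fun y _ => nn x y)
    a m ha)
  refine Finset.sum_le_sum fun x _ => ?_
  refine le_trans (le_of_eq ?_) (sum_dilate_le (fun y =>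
    if y < a * x ∧ a * x ≤ y + a * l then g y (a * x) else 0) (fun y => nn _ y) a m ha)
  refine Finset.sum_congr rfl fun y _ => ?_
  have e : (a * y < a * x ∧ a * x ≤ a * y + a * l) ↔ (y < x ∧ x ≤ y + l) := by
    rw [← mul_add, Nat.mul_lt_mul_left ha, Nat.mul_le_mul_left_iff ha]
  simp only [e]

theorem pairSum_one (m l : ℕ) (h : l ≤ m) :
    pairSum (fun _ _ => 1) m l = (m : ℝ) * l - l * (l + 1) / 2 := by
  unfold pairSum
  induction l with
  | zero => simp
  | succ l ih =>
    rw [Finset.sum_Ioc_succ_top (Nat.zero_le l), ih (by omega)]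
    simp only [Finset.sum_const, Nat.card_Ioc, nsmul_eq_mul, mul_one, Nat.sub_zero]
    rw [Nat.cast_sub h]
    push_cast
    ring

/-- A point j is the larger element of at most min(j, l) pairs and the smaller one of at most min(m
- j, l). -/
theorem pairSum_add_le (q : ℕ → ℝ) (hq : ∀ i, 0 ≤ q i) (m l : ℕ) :
    pairSum (fun x y => q x + q y) m l ≤
      ∑ j ∈ Ioc 0 m, q j * (min (j : ℝ) l + min ((m : ℝ) - j) l) := by
  rw [pairSum_eq]
  have e : ∀ x ∈ Ioc 0 m, ∀ y ∈ Ioc 0 m, (if y < x ∧ x ≤ y + l then q y + q x else 0) =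
      (q x * if y < x ∧ x ≤ y + l then 1 else 0) + q y * if y < x ∧ x ≤ y + l then 1 else 0 := by
    intro x _ y _
    split_ifs <;> ring
  rw [Finset.sum_congr rfl fun x hx => Finset.sum_congr rfl (e x hx)]
  simp only [Finset.sum_add_distrib]
  rw [Finset.sum_comm (f := fun x y => q y * if y < x ∧ x ≤ y + l then (1 : ℝ) else 0)]
  simp only [← Finset.mul_sum, mul_add, Finset.sum_add_distrib]
  refine add_le_add (Finset.sum_le_sum fun j hj => mul_le_mul_of_nonneg_left ?_ (hq j))
    (Finset.sum_le_sum fun j hj => mul_le_mul_of_nonneg_left ?_ (hq j))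
  · rw [← Finset.sum_filter, Finset.sum_const, nsmul_eq_mul, mul_one]
    refine le_min ?_ ?_
    · have : #(filter (fun y => y < j ∧ j ≤ y + l) (Ioc 0 m)) ≤ #(Ico 0 j) := by
        refine card_le_card fun y hy => ?_
        rw [mem_filter, mem_Ioc] at hy; rw [mem_Ico]; omega
      rw [Nat.card_Ico] at this
      exact_mod_cast this
    · have : #(filter (fun y => y < j ∧ j ≤ y + l) (Ioc 0 m)) ≤ #(Ico (j - l) j) := by
        refine card_le_card fun y hy => ?_
        rw [mem_filter, mem_Ioc] at hy; rw [mem_Ico]; omega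
      rw [Nat.card_Ico] at this
      have h2 : j - (j - l) ≤ l := by omega
      exact_mod_cast this.trans h2
  · rw [← Finset.sum_filter, Finset.sum_const, nsmul_eq_mul, mul_one]
    rw [mem_Ioc] at hj
    refine le_min ?_ ?_
    · have : #(filter (fun x => j < x ∧ x ≤ j + l) (Ioc 0 m)) ≤ #(Ioc j m) := by
        refine card_le_card fun y hy => ?_
        rw [mem_filter, mem_Ioc] at hy; rw [mem_Ioc]; omega
      rw [Nat.card_Ioc] at this
      rw [← Nat.cast_sub hj.2]
      exact_mod_cast this
    · have : #(filter (fun x => j < x ∧ x ≤ j + l) (Ioc 0 m)) ≤ #(Ioc j (j + l)) := by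
        refine card_le_card fun y hy => ?_
        rw [mem_filter, mem_Ioc] at hy; rw [mem_Ioc]; omega
      rw [Nat.card_Ioc] at this
      have h2 : j + l - j ≤ l := by omega
      exact_mod_cast this.trans h2

/-- Pairs of multiples of `a` in the first color, compared with all pairs of multiples. -/
theorem pairSum_multiples_ge (t : ℕ → ℝ) (h0 : ∀ i, 0 ≤ t i) (h1 : ∀ i, t i ≤ 1) (a l : ℕ)
    (ha : 0 < a) :
    (a : ℝ) * l * l - l * (l + 1) / 2
      - ∑ j ∈ Ioc 0 (a * l), (1 - t j) * (min (j : ℝ) l + min ((a : ℝ) * l - j) l)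
      + (∑ i ∈ range a, winMass (fun j => 1 - t j) l i ^ 2) / 2 - a * l / 2
      ≤ pairSum (fun x y => t x * t y) (a * l) l := by
  -- Inclusion–exclusion: with q = 1 - t, t t' = 1 - (q + q') + q q'.
  have e : pairSum (fun x y => t x * t y) (a * l) l = pairSum (fun _ _ => 1) (a * l) l -
      pairSum (fun x y => (1 - t x) + (1 - t y)) (a * l) l +
      pairSum (fun x y => (1 - t x) * (1 - t y)) (a * l) l := by
    unfold pairSum
    rw [← Finset.sum_sub_distrib, ← Finset.sum_add_distrib]
    refine Finset.sum_congr rfl fun k _ => ?_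
    rw [← Finset.sum_sub_distrib, ← Finset.sum_add_distrib]
    refine Finset.sum_congr rfl fun y _ => ?_
    ring
  have b1 := pairSum_one (a * l) l (Nat.le_mul_of_pos_left l ha)
  have b2 := pairSum_add_le (fun j => 1 - t j) (fun i => by linarith [h1 i]) (a * l) l
  have b3 := pairSum_ge_sq (fun j => 1 - t j) (fun i => by linarith [h1 i])
    (fun i => by linarith [h0 i]) a l
  push_cast at b1 b2 b3
  rw [e, b1]
  linarith

/-- If the first color is sparse enough, turning a multiple of `a` into the second color costs. -/
theorem colorSum_ge_of_sparse (r : ℕ → ℝ) (h0 : ∀ i, 0 ≤ r i) (h1 : ∀ i, r i ≤ 1) (a l : ℕ)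
    (ha : 2 ≤ a)
    (hR : 2 * mass r (a * (a * l)) ≤ ((a : ℝ) ^ 2 - a - 1) * l) :
    (a : ℝ) * l * l - l * (l + 1) / 2 - a * l / 2 ≤ colorSum r a (a * (a * l)) (a * l) := by
  have ha0 : 0 < a := by omega
  rw [colorSum_eq r a _ _ (Nat.le_mul_of_pos_left _ ha0)]
  have b1 := pairSum_dilate_le (fun x y => r x * r y) (fun x y => mul_nonneg (h0 x) (h0 y)) a
    (a * l) l ha0
  have b2 := pairSum_multiples_ge (fun j => r (a * j)) (fun i => h0 _) (fun i => h1 _) a l ha0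
  have b3 : 0 ≤ ∑ i ∈ range a, winMass (fun j => 1 - r (a * j)) l i ^ 2 :=
    Finset.sum_nonneg fun i _ => sq_nonneg _
  -- Sparsity gives a gap of at least (a + 1)l - k. This dominates the pairs lost at k: at most 2l
  -- of them for k ≤ (a - 1)l, and at most l + (al - k) beyond.
  have b4 : ∑ j ∈ Ioc 0 (a * l), (1 - r (a * j)) * (min (j : ℝ) l + min ((a : ℝ) * l - j) l) ≤
      ∑ k ∈ Ioc 0 (a * l), (1 - r (a * k)) * gap r (a * (a * l)) k := by
    refine Finset.sum_le_sum fun k hk => mul_le_mul_of_nonneg_left ?_ (by linarith [h1 (a * k)])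
    rw [mem_Ioc] at hk
    have g1 := mass_nonneg h0 k
    have g2 := mass_mono h0 (Nat.sub_le (a * (a * l)) k)
    have m1 := min_le_right (k : ℝ) l
    have m2 := min_le_right ((a : ℝ) * l - k) l
    have m3 := min_le_left ((a : ℝ) * l - k) l
    unfold gap
    push_cast
    have hl : (0 : ℝ) ≤ l := Nat.cast_nonneg l
    have ha' : (2 : ℝ) ≤ a := by exact_mod_cast ha
    rcases le_total (k : ℝ) ((a - 1) * l) with h | h <;> nlinarith
  linarith

/-! ### Dense first color: convexity, color symmetry, and a = 5, 6, 7. -/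

/-- Mass of the weight `r` on the last `k` elements of `(0, n]`. -/
noncomputable def tail (r : ℕ → ℝ) (n k : ℕ) : ℝ := mass r n - mass r (n - k)

theorem gap_eq (r : ℕ → ℝ) (n k : ℕ) :
    gap r n k = (n : ℝ) - 2 * mass r n - k + mass r k + tail r n k := by
  unfold gap tail; ring

theorem tail_nonneg {r : ℕ → ℝ} (h0 : ∀ i, 0 ≤ r i) (n k : ℕ) : 0 ≤ tail r n k := by
  have := mass_mono h0 (Nat.sub_le n k)
  unfold tail; linarith

theorem tail_mono {r : ℕ → ℝ} (h0 : ∀ i, 0 ≤ r i) (n : ℕ) {j k : ℕ} (h : j ≤ k) :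
    tail r n j ≤ tail r n k := by
  have := mass_mono h0 (Nat.sub_le_sub_left h n)
  unfold tail; linarith

theorem tail_sub_le {r : ℕ → ℝ} (h1 : ∀ i, r i ≤ 1) {n j k : ℕ} (h : j ≤ k) (hk : k ≤ n) :
    tail r n k - tail r n j ≤ (k : ℝ) - j := by
  have := mass_sub_le h1 (Nat.sub_le_sub_left h n)
  rw [Nat.cast_sub hk, Nat.cast_sub (h.trans hk)] at this
  unfold tail; linarith

theorem tail_zero (r : ℕ → ℝ) (n : ℕ) : tail r n 0 = 0 := by simp [tail]

theorem mass_zero (r : ℕ → ℝ) : mass r 0 = 0 := by simp [mass]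

theorem tail_le {r : ℕ → ℝ} (h1 : ∀ i, r i ≤ 1) {n k : ℕ} (hk : k ≤ n) : tail r n k ≤ k := by
  have := tail_sub_le h1 (Nat.zero_le k) hk
  simpa [tail_zero] using this

theorem mass_window_zero (r : ℕ → ℝ) (K : ℕ) : mass r K = winMass r K 0 := by
  simp [mass, winMass]

theorem tail_window_last (r : ℕ → ℝ) (a K : ℕ) : tail r ((a + 1) * K) K = winMass r K a := by
  unfold tail
  have e : (a + 1) * K - K = a * K := by rw [Nat.add_mul, one_mul, Nat.add_sub_cancel]
  rw [e, mass_mul, mass_mul, Finset.sum_range_succ]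
  ring

theorem sum_mul_ge_neg {ι : Type*} (s : Finset ι) (q G B : ι → ℝ) (hq0 : ∀ i ∈ s, 0 ≤ q i)
    (hq1 : ∀ i ∈ s, q i ≤ 1) (hG : ∀ i ∈ s, -B i ≤ G i) :
    -∑ i ∈ s, max 0 (B i) ≤ ∑ i ∈ s, q i * G i := by
  rw [← Finset.sum_neg_distrib]
  refine Finset.sum_le_sum fun i hi => ?_
  have a1 := hq0 i hi
  have a2 := hq1 i hi
  have a3 := hG i hi
  have a4 := le_max_left 0 (B i)
  have a5 := le_max_right 0 (B i)
  nlinarith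

theorem sum_Ioc_cast (K : ℕ) : ∑ k ∈ Ioc 0 K, (k : ℝ) = K * (K + 1) / 2 := by
  induction K with
  | zero => simp
  | succ K ih =>
    rw [Finset.sum_Ioc_succ_top (Nat.zero_le K), ih]
    push_cast
    ring

theorem sum_tail_ramp_le (D : ℝ) (hD : 0 ≤ D) (K : ℕ) :
    ∑ k ∈ Ioc 0 K, max 0 ((k : ℝ) - D) ≤ max 0 ((K : ℝ) - D) ^ 2 / 2 + K / 2 := by
  have h := (abs_le.1 (sum_ramp_bounds D K)).2
  rw [max_eq_left (by linarith : -D ≤ 0)] at h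
  linarith

/-- Convexity bound for the pairs of the first color against the trivial bound for the gap. -/
theorem colorSum_ge_convex (r : ℕ → ℝ) (h0 : ∀ i, 0 ≤ r i) (h1 : ∀ i, r i ≤ 1) (a K : ℕ)
    (ha : 0 < a) (hR : 2 * mass r (a * K) ≤ a * K) :
    mass r (a * K) ^ 2 / (2 * a) - max 0 ((K : ℝ) - (a * K - 2 * mass r (a * K))) ^ 2 / 2
      - (a + 1) * K / 2 ≤ colorSum r a (a * K) K := by
  rw [colorSum_eq r a _ _ (Nat.le_mul_of_pos_left _ ha)]
  have b1 := pairSum_ge_sq r h0 h1 a K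
  have b2 := sum_tail_ramp_le (a * K - 2 * mass r (a * K)) (by linarith) K
  have b3 := sum_mul_ge_neg (Ioc 0 K) (fun k => 1 - r (a * k)) (fun k => gap r (a * K) k)
    (fun k => (k : ℝ) - (a * K - 2 * mass r (a * K))) (fun k _ => by linarith [h1 (a * k)])
    (fun k _ => by linarith [h0 (a * k)]) (fun k _ => by
      rw [gap_eq]
      push_cast
      linarith [mass_nonneg h0 k, tail_nonneg h0 (a * K) k])
  have b4 : mass r (a * K) ^ 2 / a ≤ ∑ i ∈ range a, winMass r K i ^ 2 := by
    rw [mass_mul, div_le_iff₀ (by exact_mod_cast ha), mul_comm]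
    have := sq_sum_le_card_mul_sum_sq (s := range a) (f := fun i => winMass r K i)
    rwa [card_range] at this
  have e : mass r (a * K) ^ 2 / (2 * a) = mass r (a * K) ^ 2 / a / 2 := by
    rw [div_div, mul_comm (2 : ℝ)]
  rw [e]
  linarith

theorem sum_sq_add_compl (r : ℕ → ℝ) (a K : ℕ) :
    ∑ i ∈ range a, winMass r K i ^ 2 + ∑ i ∈ range a, winMass (fun i => 1 - r i) K i ^ 2 =
      ∑ i ∈ range a, ((K : ℝ) ^ 2 + (2 * winMass r K i - K) ^ 2) / 2 := by
  rw [← Finset.sum_add_distrib]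
  refine Finset.sum_congr rfl fun i _ => ?_
  rw [winMass_compl]; ring

/-- The gap is n - 2R plus the mean of the two centered quantities 2 mass - k and 2 tail - k. -/
theorem abs_gap_le (r : ℕ → ℝ) {n : ℕ} (hR : 2 * mass r n ≤ n) (k : ℕ) :
    |gap r n k| ≤ (n - 2 * mass r n) + (|2 * mass r k - k| + |2 * tail r n k - k|) / 2 := by
  rw [gap_eq, abs_le]
  have a1 := abs_le.1 (le_refl |2 * mass r k - (k : ℝ)|)
  have a2 := abs_le.1 (le_refl |2 * tail r n k - (k : ℝ)|)
  constructor <;> linarith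

/-- The symmetric bound with the windows and the trivial bound for the gap. -/
theorem colorSum_ge_symm_trivial (r : ℕ → ℝ) (h0 : ∀ i, 0 ≤ r i) (h1 : ∀ i, r i ≤ 1) (a K : ℕ)
    (ha : 0 < a) (hR : 2 * mass r (a * K) ≤ a * K) :
    ((a : ℝ) * K ^ 2 / 4 - K * (a * K - 2 * mass r (a * K)) - K * (K + 1) / 2 - a * K) / 2 ≤
      colorSum r a (a * K) K := by
  refine le_trans ?_ (colorSum_ge_symm r h0 h1 a (a * K) K (Nat.le_mul_of_pos_left _ ha))
  have b1 := pairSum_ge_sq r h0 h1 a K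
  have b2 := pairSum_ge_sq (fun i => 1 - r i) (fun i => by linarith [h1 i])
    (fun i => by linarith [h0 i]) a K
  have b3 := sum_sq_add_compl r a K
  have b4 : (a : ℝ) * (K ^ 2 / 2) ≤
      ∑ i ∈ range a, ((K : ℝ) ^ 2 + (2 * winMass r K i - K) ^ 2) / 2 := by
    have := Finset.card_nsmul_le_sum (range a)
      (fun i => ((K : ℝ) ^ 2 + (2 * winMass r K i - K) ^ 2) / 2) ((K : ℝ) ^ 2 / 2)
      (fun i _ => by nlinarith [sq_nonneg (2 * winMass r K i - K)])
    rwa [card_range, nsmul_eq_mul] at this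
  have b5 : ∑ k ∈ Ioc 0 K, |gap r (a * K) k| ≤
      ∑ k ∈ Ioc 0 K, ((a * K - 2 * mass r (a * K)) + (k : ℝ)) := by
    refine Finset.sum_le_sum fun k hk => ?_
    rw [mem_Ioc] at hk
    have hkn : k ≤ a * K := hk.2.trans (Nat.le_mul_of_pos_left _ ha)
    have := abs_gap_le r (n := a * K) (by push_cast; linarith) k
    push_cast at this
    have c1 : |2 * mass r k - k| ≤ (k : ℝ) := by
      rw [abs_le]; constructor <;> linarith [mass_nonneg h0 k, mass_le h1 k]
    have c2 : |2 * tail r (a * K) k - k| ≤ (k : ℝ) := by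
      rw [abs_le]; constructor <;> linarith [tail_nonneg h0 (a * K) k, tail_le h1 hkn]
    linarith
  rw [Finset.sum_add_distrib, sum_Ioc_cast, Finset.sum_const, Nat.card_Ioc, nsmul_eq_mul] at b5
  rw [Nat.sub_zero] at b5
  linarith

/-- The number of solutions is at least `(2a - 1)/2 · l²`, up to a linear error. -/
def LowerBound (a : ℕ) : Prop :=
  ∃ C : ℝ, ∀ (l : ℕ) (r : ℕ → ℝ), (∀ i, 0 ≤ r i) → (∀ i, r i ≤ 1) →
    2 * mass r (a * (a * l)) ≤ (a : ℝ) ^ 2 * l →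
    (2 * (a : ℝ) - 1) / 2 * l ^ 2 - C * l ≤ colorSum r a (a * (a * l)) (a * l)

theorem max_sq_cases (x : ℝ) : max 0 x ^ 2 = 0 ∧ x ≤ 0 ∨ max 0 x ^ 2 = x ^ 2 ∧ 0 ≤ x := by
  rcases le_total x 0 with h | h
  · left; rw [max_eq_left h]; simp [h]
  · right; rw [max_eq_right h]; simp [h]

theorem lowerBound_six : LowerBound 6 := by
  refine ⟨100, fun l r h0 h1 hR => ?_⟩
  have hl : (0 : ℝ) ≤ l := Nat.cast_nonneg l
  by_cases h : 2 * mass r (6 * (6 * l)) ≤ (((6 : ℕ) : ℝ) ^ 2 - (6 : ℕ) - 1) * l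
  · have := colorSum_ge_of_sparse r h0 h1 6 l (by norm_num) h
    push_cast at this ⊢
    nlinarith
  · have := colorSum_ge_convex r h0 h1 6 (6 * l) (by norm_num) (by push_cast at hR ⊢; linarith)
    push_cast at this h hR ⊢
    rw [not_le] at h
    refine le_trans ?_ this
    set R := mass r (6 * (6 * l))
    rcases max_sq_cases (6 * (l : ℝ) - (6 * (6 * l) - 2 * R)) with ⟨e, e'⟩ | ⟨e, e'⟩ <;> rw [e] <;>
      nlinarith

theorem lowerBound_seven : LowerBound 7 := by
  refine ⟨100, fun l r h0 h1 hR => ?_⟩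
  have hl : (0 : ℝ) ≤ l := Nat.cast_nonneg l
  by_cases h : 2 * mass r (7 * (7 * l)) ≤ (((7 : ℕ) : ℝ) ^ 2 - (7 : ℕ) - 1) * l
  · have := colorSum_ge_of_sparse r h0 h1 7 l (by norm_num) h
    push_cast at this ⊢
    nlinarith
  · have := colorSum_ge_convex r h0 h1 7 (7 * l) (by norm_num) (by push_cast at hR ⊢; linarith)
    push_cast at this h hR ⊢
    rw [not_le] at h
    refine le_trans ?_ this
    set R := mass r (7 * (7 * l))
    rcases max_sq_cases (7 * (l : ℝ) - (7 * (7 * l) - 2 * R)) with ⟨e, e'⟩ | ⟨e, e'⟩ <;> rw [e] <;>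
      nlinarith

/-- Near R = n/2 = 25l/2 the convexity bound drops to about 25l²/8, below the required 9l²/2. The
symmetric bound takes over from 49l/4, where both bounds hold with room to spare. -/
theorem lowerBound_five : LowerBound 5 := by
  refine ⟨100, fun l r h0 h1 hR => ?_⟩
  have hl : (0 : ℝ) ≤ l := Nat.cast_nonneg l
  by_cases h : 2 * mass r (5 * (5 * l)) ≤ (((5 : ℕ) : ℝ) ^ 2 - (5 : ℕ) - 1) * l
  · have := colorSum_ge_of_sparse r h0 h1 5 l (by norm_num) h
    push_cast at this ⊢
    nlinarith
  have hR' : 2 * mass r (5 * (5 * l)) ≤ ((5 : ℕ) : ℝ) * ((5 * l : ℕ) : ℝ) := by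
    push_cast at hR ⊢; linarith
  by_cases h2 : mass r (5 * (5 * l)) ≤ 49 / 4 * l
  · have := colorSum_ge_convex r h0 h1 5 (5 * l) (by norm_num) hR'
    push_cast at this h hR ⊢
    rw [not_le] at h
    refine le_trans ?_ this
    set R := mass r (5 * (5 * l))
    rcases max_sq_cases (5 * (l : ℝ) - (5 * (5 * l) - 2 * R)) with ⟨e, e'⟩ | ⟨e, e'⟩ <;> rw [e] <;>
      nlinarith
  · have := colorSum_ge_symm_trivial r h0 h1 5 (5 * l) (by norm_num) hR'
    push_cast at this h hR ⊢
    refine le_trans ?_ this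
    set R := mass r (5 * (5 * l))
    nlinarith

/-! ### Estimates from both ends of the outer windows, and a = 4. -/

theorem mass_sub_window {r : ℕ → ℝ} (h0 : ∀ i, 0 ≤ r i) (h1 : ∀ i, r i ≤ 1) {k K : ℕ}
    (h : k ≤ K) : winMass r K 0 - (K - k) ≤ mass r k ∧ mass r k ≤ winMass r K 0 := by
  rw [← mass_window_zero]
  exact ⟨by linarith [mass_sub_le h1 h], mass_mono h0 h⟩

theorem tail_sub_window {r : ℕ → ℝ} (h0 : ∀ i, 0 ≤ r i) (h1 : ∀ i, r i ≤ 1) (a : ℕ) {k K : ℕ}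
    (h : k ≤ K) : winMass r K a - (K - k) ≤ tail r ((a + 1) * K) k ∧
      tail r ((a + 1) * K) k ≤ winMass r K a := by
  rw [← tail_window_last]
  exact ⟨by linarith [tail_sub_le h1 h (Nat.le_mul_of_pos_left K (Nat.succ_pos a))],
    tail_mono h0 _ h⟩

/-- The area under the graph of `min k (E - k)` when `K ≤ E`. -/
theorem sum_min_le (E : ℝ) (hE : 0 ≤ E) (K : ℕ) :
    ∑ k ∈ Ioc 0 K, min (k : ℝ) (E - k) ≤ (K : ℝ) ^ 2 / 2 - max 0 (K - E / 2) ^ 2 + 2 * K := by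
  have h := (abs_le.1 (sum_ramp_bounds (E / 2) K)).1
  rw [max_eq_left (by linarith : -(E / 2) ≤ 0)] at h
  have e : ∀ k ∈ Ioc 0 K, min (k : ℝ) (E - k) = k - 2 * max 0 ((k : ℝ) - E / 2) := by
    intro k _
    rcases le_total (k : ℝ) (E / 2) with h | h
    · rw [min_eq_left (by linarith), max_eq_left (by linarith)]; ring
    · rw [min_eq_right (by linarith), max_eq_right (by linarith)]; ring
  rw [Finset.sum_congr rfl e, Finset.sum_sub_distrib, ← Finset.mul_sum, sum_Ioc_cast]
  linarith

/-- Convexity bound for the pairs, with the gap bounded from both ends of the window. -/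
theorem colorSum_four_convex (r : ℕ → ℝ) (h0 : ∀ i, 0 ≤ r i) (h1 : ∀ i, r i ≤ 1) (K : ℕ) (w : ℝ)
    (hw : w = winMass r K 0 + winMass r K 3) :
    w ^ 2 / 4 + (mass r (4 * K) - w) ^ 2 / 4
      - max 0 (2 * mass r (4 * K) - 3 * K - w / 2) ^ 2 - 4 * K ≤ colorSum r 4 (4 * K) K := by
  rw [colorSum_eq r 4 _ _ (Nat.le_mul_of_pos_left _ (by norm_num))]
  have b1 := pairSum_ge_sq r h0 h1 4 K
  have b0 := mass_mul r 4 K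
  simp only [Finset.sum_range_succ, Finset.sum_range_zero, zero_add] at b0 b1
  set h := 2 * mass r (4 * K) - 3 * K - w / 2 with hh
  have b3 := sum_mul_ge_neg (Ioc 0 K) (fun k => 1 - r (4 * k)) (fun k => gap r (4 * K) k)
    -- The head and tail masses are nonnegative, and also at least the outer window masses minus 2(K
    -- - k) in total. The resulting lower bounds for the gap, of slopes -1 and 1, meet at (2K - w)/2
    -- with value -h.
    (fun k => max 0 h - |(k : ℝ) - (2 * K - w) / 2|) (fun k _ => by linarith [h1 (4 * k)])
    (fun k _ => by linarith [h0 (4 * k)]) (fun k hk => by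
      rw [mem_Ioc] at hk
      rw [gap_eq]
      push_cast
      have m := le_max_right 0 h
      have t1 := mass_sub_window h0 h1 hk.2
      have t2 := tail_sub_window h0 h1 3 hk.2
      have t3 := mass_nonneg h0 k
      have t4 := tail_nonneg h0 (4 * K) k
      norm_num at t2
      rcases abs_cases ((k : ℝ) - (2 * K - w) / 2) with ⟨e, _⟩ | ⟨e, _⟩ <;> rw [e] <;> linarith)
  have b2 := sum_tent_le ((2 * K - w) / 2) (max 0 h) (le_max_left _ _) K
  have c1 := sq_nonneg (winMass r K 0 - winMass r K 3)
  have c2 := sq_nonneg (winMass r K 1 - winMass r K 2)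
  have e1 : mass r (4 * K) - w = winMass r K 1 + winMass r K 2 := by rw [b0, hw]; ring
  rw [e1, hw]
  push_cast at b1
  linarith

theorem abs_centered_mass_le {r : ℕ → ℝ} (h0 : ∀ i, 0 ≤ r i) (h1 : ∀ i, r i ≤ 1) {k K : ℕ}
    (h : k ≤ K) : |2 * mass r k - k| ≤ min (k : ℝ) (|2 * winMass r K 0 - K| + K - k) := by
  have t1 := mass_sub_window h0 h1 h
  have t2 := mass_sub_le h1 h
  have t3 := mass_mono h0 h
  have t4 := le_abs_self (2 * winMass r K 0 - K)
  have t5 := neg_le_abs (2 * winMass r K 0 - K)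
  refine le_min ?_ ?_ <;> rw [abs_le] <;> constructor <;>
    linarith [mass_nonneg h0 k, mass_le h1 k]

theorem abs_centered_tail_le {r : ℕ → ℝ} (h0 : ∀ i, 0 ≤ r i) (h1 : ∀ i, r i ≤ 1) (a : ℕ) {k K : ℕ}
    (h : k ≤ K) : |2 * tail r ((a + 1) * K) k - k| ≤
      min (k : ℝ) (|2 * winMass r K a - K| + K - k) := by
  have t1 := tail_sub_window h0 h1 a h
  have hn : k ≤ (a + 1) * K := h.trans (Nat.le_mul_of_pos_left K (Nat.succ_pos a))
  have t4 := le_abs_self (2 * winMass r K a - K)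
  have t5 := neg_le_abs (2 * winMass r K a - K)
  refine le_min ?_ ?_ <;> rw [abs_le] <;> constructor <;>
    linarith [tail_nonneg h0 ((a + 1) * K) k, tail_le h1 hn]

/-- The symmetric bound with the gap bounded from both ends of the window. -/
theorem colorSum_four_symm (r : ℕ → ℝ) (h0 : ∀ i, 0 ≤ r i) (h1 : ∀ i, r i ≤ 1) (K : ℕ)
    (hR : 2 * mass r (4 * K) ≤ 4 * K) :
    5 / 16 * (K : ℝ) ^ 2 - K * (4 * K - 2 * mass r (4 * K)) / 2 - 10 * K ≤
      colorSum r 4 (4 * K) K := by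
  refine le_trans ?_ (colorSum_ge_symm r h0 h1 4 (4 * K) K (Nat.le_mul_of_pos_left _ (by norm_num)))
  have b1 := pairSum_ge_sq r h0 h1 4 K
  have b2 := pairSum_ge_sq (fun i => 1 - r i) (fun i => by linarith [h1 i])
    (fun i => by linarith [h0 i]) 4 K
  have b3 := sum_sq_add_compl r 4 K
  have b5 : ∑ k ∈ Ioc 0 K, |gap r (4 * K) k| ≤
      ∑ k ∈ Ioc 0 K, ((4 * K - 2 * mass r (4 * K)) +
        (min (k : ℝ) (|2 * winMass r K 0 - K| + K - k) +
          min (k : ℝ) (|2 * winMass r K 3 - K| + K - k)) / 2) := by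
    refine Finset.sum_le_sum fun k hk => ?_
    rw [mem_Ioc] at hk
    have t0 := abs_gap_le r (n := 4 * K) (by push_cast; linarith) k
    have t1 := abs_centered_mass_le h0 h1 hk.2
    have t2 : |2 * tail r (4 * K) k - k| ≤ _ := abs_centered_tail_le h0 h1 3 hk.2
    push_cast at t0
    linarith
  rw [Finset.sum_add_distrib, Finset.sum_const, Nat.card_Ioc, nsmul_eq_mul, Nat.sub_zero,
    ← Finset.sum_div, Finset.sum_add_distrib] at b5
  simp only [Finset.sum_range_succ, Finset.sum_range_zero, zero_add] at b1 b2 b3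
  push_cast at b1 b2
  have hK : (0 : ℝ) ≤ K := Nat.cast_nonneg K
  have key : ∀ x : ℝ, 0 ≤ |x| + K ∧
      (K : ℝ) ^ 2 / 2 - max 0 (K - (|x| + K) / 2) ^ 2 ≤ (K : ℝ) ^ 2 / 4 + K * |x| / 2 := by
    intro x
    have := abs_nonneg x
    refine ⟨by linarith, ?_⟩
    have m := le_max_right 0 (K - (|x| + K) / 2)
    have m0 := le_max_left 0 (K - (|x| + K) / 2)
    rcases max_sq_cases (K - (|x| + K) / 2) with ⟨e, e'⟩ | ⟨e, e'⟩ <;> rw [e] <;> nlinarith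
  have s1 := sum_min_le _ (key (2 * winMass r K 0 - K)).1 K
  have s2 := sum_min_le _ (key (2 * winMass r K 3 - K)).1 K
  have s3 := (key (2 * winMass r K 0 - K)).2
  have s4 := (key (2 * winMass r K 3 - K)).2
  have q1 := sq_nonneg (2 * |2 * winMass r K 0 - K| - K)
  have q2 := sq_nonneg (2 * |2 * winMass r K 3 - K| - K)
  have q3 := sq_nonneg (2 * winMass r K 1 - K)
  have q4 := sq_nonneg (2 * winMass r K 2 - K)
  have e1 := sq_abs (2 * winMass r K 0 - K)
  have e2 := sq_abs (2 * winMass r K 3 - K)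
  linarith

theorem lowerBound_four : LowerBound 4 := by
  refine ⟨100, fun l r h0 h1 hR => ?_⟩
  have hl : (0 : ℝ) ≤ l := Nat.cast_nonneg l
  by_cases h : 2 * mass r (4 * (4 * l)) ≤ (((4 : ℕ) : ℝ) ^ 2 - (4 : ℕ) - 1) * l
  · have := colorSum_ge_of_sparse r h0 h1 4 l (by norm_num) h
    push_cast at this ⊢
    nlinarith
  -- The symmetric bound reaches 7l²/2 at R = 61l/8, just below this threshold. In the convex branch
  -- with positive height, w = 111l/100 minimizes the bound at the threshold.
  by_cases h2 : mass r (4 * (4 * l)) ≤ 763 / 100 * l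
  · have := colorSum_four_convex r h0 h1 (4 * l) _ rfl
    have w0 := winMass_nonneg h0 (4 * l) 0
    have w3 := winMass_nonneg h0 (4 * l) 3
    push_cast at this h hR ⊢
    rw [not_le] at h
    refine le_trans ?_ this
    set R := mass r (4 * (4 * l))
    set w := winMass r (4 * l) 0 + winMass r (4 * l) 3
    rcases max_sq_cases (2 * R - 3 * (4 * l) - w / 2) with ⟨e, e'⟩ | ⟨e, e'⟩ <;> rw [e]
    · nlinarith [sq_nonneg (R - 2 * w)]
    · clear w0 w3 hR this e
      nlinarith [sq_nonneg (w - 111 / 100 * l), mul_nonneg (sub_nonneg.2 h2) hl,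
        mul_nonneg (sub_nonneg.2 h2) (sub_nonneg.2 h.le)]
  · have := colorSum_four_symm r h0 h1 (4 * l) (by push_cast at hR ⊢; linarith)
    push_cast at this h hR ⊢
    refine le_trans ?_ this
    set R := mass r (4 * (4 * l))
    nlinarith

/-! ### a = 3: colorings close to the coloring by multiples. -/

theorem sum_multiples_three (f : ℕ → ℝ) (m : ℕ) :
    ∑ x ∈ Ioc 0 (3 * m), (if 3 ∣ x then f x else 0) = ∑ x ∈ Ioc 0 m, f (3 * x) := by
  induction m with
  | zero => simp
  | succ m ih =>
    have e : 3 * (m + 1) = 3 * m + 1 + 1 + 1 := by ring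
    rw [e, Finset.sum_Ioc_succ_top (Nat.zero_le _), Finset.sum_Ioc_succ_top (Nat.zero_le _),
      Finset.sum_Ioc_succ_top (Nat.zero_le _), ih, Finset.sum_Ioc_succ_top (Nat.zero_le m),
      if_neg (by omega), if_neg (by omega), if_pos (by omega), ← e]
    ring

theorem mass_dilate_sub_le {r : ℕ → ℝ} (h0 : ∀ i, 0 ≤ r i) {m M : ℕ} (h : m ≤ M) :
    mass (fun j => r (3 * j)) M - mass (fun j => r (3 * j)) m ≤ mass r (3 * M) - mass r (3 * m) := by
  have : Monotone fun m => mass r (3 * m) - mass (fun j => r (3 * j)) m := by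
    refine monotone_nat_of_le_succ fun m => ?_
    unfold mass
    have e : 3 * (m + 1) = 3 * m + 1 + 1 + 1 := by ring
    rw [Finset.sum_Ioc_succ_top (Nat.zero_le m), e, Finset.sum_Ioc_succ_top (Nat.zero_le _),
      Finset.sum_Ioc_succ_top (Nat.zero_le _), Finset.sum_Ioc_succ_top (Nat.zero_le _), ← e]
    linarith [h0 (3 * m + 1), h0 (3 * m + 1 + 1)]
  have := this h
  simp only at this
  linarith

theorem gap_three_ge {r : ℕ → ℝ} (h0 : ∀ i, 0 ≤ r i) (h1 : ∀ i, r i ≤ 1) (l k : ℕ)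
    (hk : k ≤ 3 * l) :
    (9 * l : ℝ) - 2 * mass r (3 * (3 * l)) - k / 3 - mass (fun j => 1 - r (3 * j)) (3 * l) - 2 ≤
      gap r (3 * (3 * l)) k := by
  rw [gap_eq]
  unfold tail
  set k' := k / 3 with hk'
  have a1 := mass_dilate_sub_le h0 (Nat.zero_le k')
  have a2 := mass_dilate_sub_le h0 (by omega : 3 * l - k' ≤ 3 * l)
  have a3 := mass_mono h0 (by omega : 3 * k' ≤ k)
  have a4 := mass_mono h0 (by omega : 3 * (3 * l) - k ≤ 3 * (3 * l - k'))
  have q0 : ∀ i, 0 ≤ (fun j => 1 - r (3 * j)) i := fun i => by linarith [h1 (3 * i)]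
  have a5 := mass_mono q0 (by omega : k' ≤ 3 * l - k')
  have c1 := mass_compl (fun j => r (3 * j)) k'
  have c2 := mass_compl (fun j => r (3 * j)) (3 * l)
  have c3 := mass_compl (fun j => r (3 * j)) (3 * l - k')
  rw [Nat.cast_sub (by omega)] at c3
  rw [mul_zero, mass_zero, mass_zero] at a1
  have a6 : (k : ℝ) ≤ 3 * k' + 2 := by
    have : k ≤ 3 * k' + 2 := by omega
    exact_mod_cast this
  push_cast at c1 c2 c3 a5 ⊢
  linarith

/-- The pairs of the first color: the pairs of multiples of three, and the other pairs inside the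
windows. -/
theorem pairSum_multiples_add_ge (r : ℕ → ℝ) (h0 : ∀ i, 0 ≤ r i) (h1 : ∀ i, r i ≤ 1) (l : ℕ) :
    pairSum (fun x y => r (3 * x) * r (3 * y)) (3 * l) l +
      (∑ i ∈ range 3, winMass r (3 * l) i ^ 2) / 2 -
      (∑ i ∈ range 3, winMass (fun j => r (3 * j)) l i ^ 2) / 2 - 5 * l ≤
      pairSum (fun x y => r x * r y) (3 * (3 * l)) (3 * l) := by
  set t : ℕ → ℝ := fun x => if 3 ∣ x then r x else 0 with ht
  have t0 : ∀ x, 0 ≤ t x := fun x => by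
    simp only [ht]; split_ifs
    · exact h0 x
    · exact le_rfl
  have tr : ∀ x, t x ≤ r x := fun x => by
    simp only [ht]; split_ifs
    · exact le_rfl
    · exact h0 x
  have e : pairSum (fun x y => r x * r y) (3 * (3 * l)) (3 * l) =
      pairSum (fun x y => t x * t y) (3 * (3 * l)) (3 * l) +
      pairSum (fun x y => r x * r y - t x * t y) (3 * (3 * l)) (3 * l) := by
    unfold pairSum
    rw [← Finset.sum_add_distrib]
    refine Finset.sum_congr rfl fun k _ => ?_
    rw [← Finset.sum_add_distrib]
    exact Finset.sum_congr rfl fun y _ => by ring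
  have b1 := pairSum_dilate_le (fun x y => t x * t y) (fun x y => mul_nonneg (t0 x) (t0 y)) 3
    (3 * l) l (by norm_num)
  have e1 : pairSum (fun x y => t (3 * x) * t (3 * y)) (3 * l) l =
      pairSum (fun x y => r (3 * x) * r (3 * y)) (3 * l) l := by
    simp [ht]
  have b2 := pairSum_ge_windows (fun x y => r x * r y - t x * t y) (fun x y => by
    have := mul_le_mul (tr x) (tr y) (t0 y) (h0 x)
    linarith) 3 (3 * l)
  have b3 : ∀ i ∈ range 3, winMass r (3 * l) i ^ 2 / 2 - winMass (fun j => r (3 * j)) l i ^ 2 / 2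
      - 3 * l / 2 ≤ ∑ z ∈ Ioc 0 (3 * l), ∑ z' ∈ Ioc 0 (3 * l), (if z' < z then
        r (i * (3 * l) + z') * r (i * (3 * l) + z) - t (i * (3 * l) + z') * t (i * (3 * l) + z)
        else 0) := by
    intro i _
    have s1 := sum_lt_mul_eq (fun z => r (i * (3 * l) + z)) (3 * l)
    have s2 := sum_lt_mul_eq (fun z => t (i * (3 * l) + z)) (3 * l)
    have s3 : ∑ z ∈ Ioc 0 (3 * l), r (i * (3 * l) + z) ^ 2 ≤ 3 * l := by
      refine (Finset.sum_le_sum fun z _ => pow_le_one₀ (h0 _) (h1 _)).trans ?_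
      simp
    have s4 : 0 ≤ ∑ z ∈ Ioc 0 (3 * l), t (i * (3 * l) + z) ^ 2 :=
      Finset.sum_nonneg fun z _ => sq_nonneg _
    have s5 : ∑ z ∈ Ioc 0 (3 * l), t (i * (3 * l) + z) = winMass (fun j => r (3 * j)) l i := by
      unfold winMass
      have : ∀ z, t (i * (3 * l) + z) = if 3 ∣ z then r (i * (3 * l) + z) else 0 := by
        intro z
        have hd : 3 ∣ i * (3 * l) := ⟨i * l, by ring⟩
        simp only [ht, Nat.dvd_add_right hd]
      simp only [this]
      rw [sum_multiples_three (fun z => r (i * (3 * l) + z))]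
      refine Finset.sum_congr rfl fun z _ => ?_
      congr 1; ring
    have s6 : ∑ z ∈ Ioc 0 (3 * l), ∑ z' ∈ Ioc 0 (3 * l), (if z' < z then
        r (i * (3 * l) + z') * r (i * (3 * l) + z) - t (i * (3 * l) + z') * t (i * (3 * l) + z)
        else 0) = ∑ z ∈ Ioc 0 (3 * l), ∑ z' ∈ Ioc 0 (3 * l), (if z' < z then
        r (i * (3 * l) + z') * r (i * (3 * l) + z) else 0) -
        ∑ z ∈ Ioc 0 (3 * l), ∑ z' ∈ Ioc 0 (3 * l), (if z' < z then
        t (i * (3 * l) + z') * t (i * (3 * l) + z) else 0) := by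
      rw [← Finset.sum_sub_distrib]
      refine Finset.sum_congr rfl fun z _ => ?_
      rw [← Finset.sum_sub_distrib]
      refine Finset.sum_congr rfl fun z' _ => ?_
      split_ifs <;> ring
    rw [s6, s1, s2, s5]
    unfold winMass at *
    linarith
  have b4 := Finset.sum_le_sum b3
  simp only [Finset.sum_sub_distrib, ← Finset.sum_div, Finset.sum_const, card_range,
    nsmul_eq_mul] at b4
  have hl : (0 : ℝ) ≤ l := Nat.cast_nonneg l
  push_cast at b4
  rw [e]
  linarith

/-- The bound for colorings whose first color contains most multiples of three. -/
theorem colorSum_three_perturb (r : ℕ → ℝ) (h0 : ∀ i, 0 ≤ r i) (h1 : ∀ i, r i ≤ 1) (l : ℕ)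
    (S V : ℝ) (hS : S = mass (fun j => 1 - r (3 * j)) (3 * l))
    (hV : V = mass r (3 * (3 * l)) - 3 * l) :
    5 / 2 * (l : ℝ) ^ 2 + S * (l / 3 - 2 * V - S) + l * (S + V) + V ^ 2 / 6 - 20 * l ≤
      colorSum r 3 (3 * (3 * l)) (3 * l) ∧ 0 ≤ S + V ∧ 0 ≤ S := by
  have hl : (0 : ℝ) ≤ l := Nat.cast_nonneg l
  have q0 : ∀ i, 0 ≤ (fun j => 1 - r (3 * j)) i := fun i => by linarith [h1 (3 * i)]
  have S0 : 0 ≤ S := hS ▸ mass_nonneg q0 _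
  have S1 : S ≤ 3 * l := by
    have := mass_le (r := fun j => 1 - r (3 * j)) (fun i => by linarith [h0 (3 * i)]) (3 * l)
    rw [hS]; push_cast at this; exact this
  refine ⟨?_, ?_, S0⟩
  · rw [colorSum_eq r 3 _ _ (Nat.le_mul_of_pos_left _ (by norm_num))]
    have b1 := pairSum_multiples_add_ge r h0 h1 l
    have b2 := pairSum_multiples_ge (fun j => r (3 * j)) (fun i => h0 _) (fun i => h1 _) 3 l
      (by norm_num)
    have b3 : ∑ k ∈ Ioc 0 (3 * l), (1 - r (3 * k)) * ((min (k : ℝ) l + min ((3 : ℕ) * l - k : ℝ) l)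
        + (l / 3 - 2 * V - S - 2)) ≤
        ∑ k ∈ Ioc 0 (3 * l), (1 - r (3 * k)) * gap r (3 * (3 * l)) k := by
      refine Finset.sum_le_sum fun k hk => mul_le_mul_of_nonneg_left ?_ (q0 k)
      rw [mem_Ioc] at hk
      have g := gap_three_ge h0 h1 l k hk.2
      rw [← hS] at g
      push_cast
      have m1 := min_le_right (k : ℝ) l
      have m2 := min_le_right (3 * l - k : ℝ) l
      have m3 := min_le_left (k : ℝ) l
      have m4 := min_le_left (3 * l - k : ℝ) l
      rcases le_total (k : ℝ) (2 * l) with h | h <;> linarith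
    have b4 : ∑ k ∈ Ioc 0 (3 * l), (1 - r (3 * k)) * ((min (k : ℝ) l + min ((3 : ℕ) * l - k : ℝ) l)
        + (l / 3 - 2 * V - S - 2)) =
        ∑ k ∈ Ioc 0 (3 * l), (1 - r (3 * k)) * (min (k : ℝ) l + min ((3 : ℕ) * l - k : ℝ) l) +
        S * (l / 3 - 2 * V - S - 2) := by
      rw [hS]
      unfold mass
      rw [Finset.sum_mul, ← Finset.sum_add_distrib]
      exact Finset.sum_congr rfl fun k _ => by ring
    -- In each window the squared number of missing multiples from `b2` and the squared number of
    -- present ones from `b1` enter with opposite signs; the quadratic terms cancel and leave l * S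
    -- - 3l²/2.
    have c : ∀ i, winMass (fun j => 1 - r (3 * j)) l i = l - winMass (fun j => r (3 * j)) l i :=
      fun i => winMass_compl _ l i
    have d1 := mass_mul (fun j => 1 - r (3 * j)) 3 l
    rw [← hS] at d1
    have d2 := mass_mul r 3 (3 * l)
    simp only [c, Finset.sum_range_succ, Finset.sum_range_zero, zero_add] at b1 b2 d1 d2
    set w0 := winMass r (3 * l) 0
    set w1 := winMass r (3 * l) 1
    set w2 := winMass r (3 * l) 2
    have d3 : 9 * (l : ℝ) ^ 2 + 6 * l * V + V ^ 2 ≤ 3 * (w0 ^ 2 + w1 ^ 2 + w2 ^ 2) := by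
      have : V + 3 * l = w0 + w1 + w2 := by rw [hV, d2]; ring
      have e : 9 * (l : ℝ) ^ 2 + 6 * l * V + V ^ 2 = (V + 3 * l) ^ 2 := by ring
      rw [e, this]
      nlinarith [sq_nonneg (w0 - w1), sq_nonneg (w0 - w2), sq_nonneg (w1 - w2)]
    push_cast at b2 b4
    nlinarith
  · have := mass_dilate_sub_le h0 (Nat.zero_le (3 * l))
    have c := mass_compl (fun j => r (3 * j)) (3 * l)
    rw [mul_zero, mass_zero, mass_zero] at this
    push_cast at c
    rw [hS, hV]
    linarith

/-! ### a = 3: pairs between adjacent windows. -/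

/-- The mass of the first window above `z` and of the third window up to `z`. -/
noncomputable def crossMass (r : ℕ → ℝ) (K z : ℕ) : ℝ :=
  (mass r K - mass r z) + (mass r (2 * K + z) - mass r (2 * K))

/-- Pairs between the middle window and the outer windows. -/
noncomputable def crossSum (r : ℕ → ℝ) (K : ℕ) : ℝ :=
  ∑ z ∈ Ioc 0 K, r (K + z) * crossMass r K z

theorem crossMass_eq (r : ℕ → ℝ) {K z : ℕ} (hz : z ≤ K) :
    crossMass r K z = winMass r K 0 + winMass r K 2 - mass r z - tail r (3 * K) (K - z) := by
  have e := tail_window_last r 2 K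
  have e2 : 3 * K - (K - z) = 2 * K + z := by omega
  have e3 : 3 * K - K = 2 * K := by omega
  norm_num at e
  rw [← e, ← mass_window_zero]
  unfold crossMass tail
  rw [e2, e3]
  ring

theorem crossMass_compl (r : ℕ → ℝ) (K z : ℕ) :
    crossMass (fun i => 1 - r i) K z = K - crossMass r K z := by
  unfold crossMass
  rw [mass_compl, mass_compl, mass_compl, mass_compl]
  push_cast
  ring

theorem crossMass_ge {r : ℕ → ℝ} (h0 : ∀ i, 0 ≤ r i) (h1 : ∀ i, r i ≤ 1) {K z : ℕ} (hz : z ≤ K) :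
    max 0 (winMass r K 0 - z) + max 0 (winMass r K 2 - (K - z)) ≤ crossMass r K z := by
  have t1 := mass_sub_window h0 h1 hz
  have t2 := tail_sub_window h0 h1 2 (Nat.sub_le K z)
  have t3 := mass_le h1 z
  have t4 := tail_le h1 (n := 3 * K) (k := K - z) (by omega)
  rw [Nat.cast_sub hz] at t2 t4
  norm_num at t2
  rw [crossMass_eq r hz]
  have m1 : max 0 (winMass r K 0 - z) ≤ winMass r K 0 - mass r z :=
    max_le (by linarith) (by linarith)
  have m2 : max 0 (winMass r K 2 - (K - z)) ≤ winMass r K 2 - tail r (3 * K) (K - z) :=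
    max_le (by linarith) (by linarith)
  linarith

theorem crossMass_nonneg {r : ℕ → ℝ} (h0 : ∀ i, 0 ≤ r i) {K z : ℕ} (hz : z ≤ K) :
    0 ≤ crossMass r K z := by
  have := mass_mono h0 hz
  have := mass_mono h0 (Nat.le_add_right (2 * K) z)
  unfold crossMass; linarith

theorem pairSum_three_windows_ge (r : ℕ → ℝ) (h0 : ∀ i, 0 ≤ r i) (h1 : ∀ i, r i ≤ 1) (K : ℕ) :
    (winMass r K 0 ^ 2 + winMass r K 1 ^ 2 + winMass r K 2 ^ 2) / 2 + crossSum r K - 2 * K ≤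
      pairSum (fun x y => r x * r y) (3 * K) K := by
  refine le_trans ?_ (pairSum_three_ge _ (fun x y => mul_nonneg (h0 x) (h0 y)) K)
  have e : ∀ i ∈ range 3, winMass r K i ^ 2 / 2 - K / 2 ≤ ∑ z ∈ Ioc 0 K, ∑ z' ∈ Ioc 0 K,
      (if z' < z then r (i * K + z') * r (i * K + z) else 0) := by
    intro i _
    rw [sum_lt_mul_eq (fun z => r (i * K + z)) K]
    have : ∑ z ∈ Ioc 0 K, r (i * K + z) ^ 2 ≤ K := by
      refine (Finset.sum_le_sum fun z _ => pow_le_one₀ (h0 _) (h1 _)).trans ?_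
      simp
    unfold winMass
    linarith
  have e' := Finset.sum_le_sum e
  have c1 : ∑ z ∈ Ioc 0 K, r (K + z) * (mass r K - mass r z) ≤
      ∑ z ∈ Ioc 0 K, ∑ z' ∈ Ioc 0 K, if z ≤ z' then r z' * r (K + z) else 0 := by
    refine Finset.sum_le_sum fun z hz => ?_
    rw [mem_Ioc] at hz
    rw [mass_sub r hz.2, mul_comm, Finset.sum_mul, ← Finset.sum_filter]
    refine Finset.sum_le_sum_of_subset_of_nonneg (fun x hx => ?_)
      fun x _ _ => mul_nonneg (h0 _) (h0 _)
    rw [mem_Ioc] at hx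
    rw [mem_filter, mem_Ioc]
    omega
  have c2 : ∑ z ∈ Ioc 0 K, r (K + z) * (mass r (2 * K + z) - mass r (2 * K)) ≤
      ∑ z ∈ Ioc 0 K, ∑ z' ∈ Ioc 0 K, if z ≤ z' then r (K + z') * r (2 * K + z) else 0 := by
    rw [Finset.sum_comm (f := fun z z' => if z ≤ z' then r (K + z') * r (2 * K + z) else 0)]
    refine Finset.sum_le_sum fun z hz => ?_
    rw [mem_Ioc] at hz
    have s := sum_shift (fun i => r i) (k := 2 * K) (n := 2 * K + z) (by omega)
    rw [← s, Finset.mul_sum, ← Finset.sum_filter]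
    have e3 : 2 * K + z - 2 * K = z := by omega
    rw [e3]
    refine (Finset.sum_le_sum_of_subset_of_nonneg (fun x hx => ?_)
      fun x _ _ => mul_nonneg (h0 _) (h0 _)).trans (le_of_eq (Finset.sum_congr rfl fun x _ => ?_))
    · rw [mem_Ioc] at hx
      rw [mem_filter, mem_Ioc]
      omega
    · rw [add_comm x]
  have c3 : crossSum r K = ∑ z ∈ Ioc 0 K, r (K + z) * (mass r K - mass r z) +
      ∑ z ∈ Ioc 0 K, r (K + z) * (mass r (2 * K + z) - mass r (2 * K)) := by
    rw [← Finset.sum_add_distrib]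
    exact Finset.sum_congr rfl fun z _ => by unfold crossMass; ring
  have hK : (0 : ℝ) ≤ K := Nat.cast_nonneg K
  rw [c3]
  simp only [Finset.sum_range_succ, Finset.sum_range_zero, zero_add] at e' ⊢
  linarith

theorem winMass_one (r : ℕ → ℝ) (K : ℕ) : winMass r K 1 = ∑ z ∈ Ioc 0 K, r (K + z) := by
  simp [winMass]

/-- A trapezoid with slopes `±1`. -/
theorem sum_trapezoid_le (a b θ : ℝ) (hab : a ≤ b) (hθ : 0 ≤ θ) (K : ℕ) :
    ∑ z ∈ Ioc 0 K, (max 0 ((z : ℝ) - (a - θ)) - max 0 ((z : ℝ) - a) - max 0 ((z : ℝ) - b)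
      + max 0 ((z : ℝ) - (b + θ))) ≤ θ * (b - a) + θ ^ 2 + 2 * K := by
  rw [Finset.sum_add_distrib, Finset.sum_sub_distrib, Finset.sum_sub_distrib]
  have h1 := abs_le.1 (sum_ramp_bounds (a - θ) K)
  have h2 := abs_le.1 (sum_ramp_bounds a K)
  have h3 := abs_le.1 (sum_ramp_bounds b K)
  have h4 := abs_le.1 (sum_ramp_bounds (b + θ) K)
  have key : ∀ x : ℝ,
      max 0 (x - (a - θ)) ^ 2 / 2 - max 0 (x - a) ^ 2 / 2 - max 0 (x - b) ^ 2 / 2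
        + max 0 (x - (b + θ)) ^ 2 / 2 ≤ θ * (b - a) + θ ^ 2 ∧
      0 ≤ max 0 (x - (a - θ)) ^ 2 / 2 - max 0 (x - a) ^ 2 / 2 - max 0 (x - b) ^ 2 / 2
        + max 0 (x - (b + θ)) ^ 2 / 2 := by
    intro x
    have hm := mul_nonneg hθ (sub_nonneg.2 hab)
    rcases le_total x a with g | g
    · rw [max_eq_left (by linarith : x - a ≤ 0), max_eq_left (by linarith : x - b ≤ 0),
        max_eq_left (by linarith : x - (b + θ) ≤ 0)]
      rcases max_sq_cases (x - (a - θ)) with ⟨e1, f1⟩ | ⟨e1, f1⟩ <;> rw [e1]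
      · constructor <;> nlinarith
      · constructor <;> nlinarith
    · rw [max_eq_right (by linarith : 0 ≤ x - a), max_eq_right (by linarith : 0 ≤ x - (a - θ))]
      rcases le_total x b with g' | g'
      · rw [max_eq_left (by linarith : x - b ≤ 0), max_eq_left (by linarith : x - (b + θ) ≤ 0)]
        have := mul_nonneg hθ (sub_nonneg.2 g)
        have := mul_nonneg hθ (sub_nonneg.2 g')
        constructor <;> nlinarith
      · rw [max_eq_right (by linarith : 0 ≤ x - b)]
        have := mul_nonneg hθ (sub_nonneg.2 g')
        rcases max_sq_cases (x - (b + θ)) with ⟨e1, f1⟩ | ⟨e1, f1⟩ <;> rw [e1]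
        · have t1 := mul_nonneg (sub_nonneg.2 g') (neg_nonneg.2 f1)
          have t2 := sq_nonneg (x - b - θ)
          have t3 := sq_nonneg θ
          have t4 := sq_nonneg (x - b)
          constructor
          · linear_combination t2 / 2
          · linear_combination hm + t1 + t3 / 2 + t4 / 2
        · constructor
          · linear_combination (0 : ℝ) * hm
          · linear_combination hm + sq_nonneg θ
  have u := (key K).1
  have l := (key 0).2
  rw [zero_sub, zero_sub, zero_sub, zero_sub] at l
  linarith [h1.2, h2.1, h3.1, h4.2]

theorem crossSum_ge_mul {r : ℕ → ℝ} (h0 : ∀ i, 0 ≤ r i) (K : ℕ) (c : ℝ)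
    (hc : ∀ z ∈ Ioc 0 K, c ≤ crossMass r K z) : c * winMass r K 1 ≤ crossSum r K := by
  rw [winMass_one, Finset.mul_sum]
  refine Finset.sum_le_sum fun z hz => ?_
  have := hc z hz
  nlinarith [h0 (K + z)]

theorem crossSum_nonneg {r : ℕ → ℝ} (h0 : ∀ i, 0 ≤ r i) (K : ℕ) : 0 ≤ crossSum r K :=
  Finset.sum_nonneg fun _ hz => mul_nonneg (h0 _) (crossMass_nonneg h0 (mem_Ioc.1 hz).2)

/-- Dropping the positive parts in `crossMass_ge` leaves a bound in which z cancels. -/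
theorem crossSum_ge_of_heavy {r : ℕ → ℝ} (h0 : ∀ i, 0 ≤ r i) (h1 : ∀ i, r i ≤ 1) (K : ℕ) :
    (winMass r K 0 + winMass r K 2 - K) * winMass r K 1 ≤ crossSum r K := by
  refine crossSum_ge_mul h0 K _ fun z hz => ?_
  have := crossMass_ge h0 h1 (mem_Ioc.1 hz).2
  have := le_max_right 0 (winMass r K 0 - z)
  have := le_max_right 0 (winMass r K 2 - (K - z))
  linarith

/-- The lower bound of `crossMass_ge` vanishes between w0 and K - w2 and rises with slope 1 on both
sides. The middle mass exceeds the length of that valley by V, and filling both slopes to height V/2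
costs V²/4. -/
theorem crossSum_ge_sq {r : ℕ → ℝ} (h0 : ∀ i, 0 ≤ r i) (h1 : ∀ i, r i ≤ 1) (K : ℕ)
    (hw : winMass r K 0 + winMass r K 2 ≤ K)
    (hv : (K : ℝ) ≤ winMass r K 0 + winMass r K 1 + winMass r K 2) :
    (winMass r K 0 + winMass r K 1 + winMass r K 2 - K) ^ 2 / 4 - 2 * K ≤ crossSum r K := by
  set V := winMass r K 0 + winMass r K 1 + winMass r K 2 - K with hV
  have a1 := le_sum_weighted (Ioc 0 K) (fun z => r (K + z)) (fun z => crossMass r K z)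
    (fun _ _ => h0 _) (fun _ _ => h1 _) (V / 2)
  have a2 := sum_trapezoid_le (winMass r K 0) (K - winMass r K 2) (V / 2) (by linarith)
    (by linarith) K
  have a3 : ∑ z ∈ Ioc 0 K, max 0 (V / 2 - crossMass r K z) ≤
      ∑ z ∈ Ioc 0 K, (max 0 ((z : ℝ) - (winMass r K 0 - V / 2)) - max 0 ((z : ℝ) - winMass r K 0)
      - max 0 ((z : ℝ) - (K - winMass r K 2)) + max 0 ((z : ℝ) - (K - winMass r K 2 + V / 2))) := by
    refine Finset.sum_le_sum fun z hz => ?_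
    have m := crossMass_ge h0 h1 (mem_Ioc.1 hz).2
    have m0 := crossMass_nonneg h0 (mem_Ioc.1 hz).2
    have g1 := le_max_right 0 (winMass r K 0 - z)
    have g2 := le_max_right 0 (winMass r K 2 - (K - z))
    have g3 := le_max_left 0 (winMass r K 0 - z)
    have g4 := le_max_left 0 (winMass r K 2 - (K - z))
    refine max_le ?_ ?_ <;>
    rcases max_cases (0 : ℝ) ((z : ℝ) - (winMass r K 0 - V / 2)) with ⟨f1, f1'⟩ | ⟨f1, f1'⟩ <;>
    rcases max_cases (0 : ℝ) ((z : ℝ) - winMass r K 0) with ⟨f2, f2'⟩ | ⟨f2, f2'⟩ <;>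
    rcases max_cases (0 : ℝ) ((z : ℝ) - (K - winMass r K 2)) with ⟨f3, f3'⟩ | ⟨f3, f3'⟩ <;>
    rcases max_cases (0 : ℝ) ((z : ℝ) - (K - winMass r K 2 + V / 2)) with ⟨f4, f4'⟩ | ⟨f4, f4'⟩ <;>
    rw [f1, f2, f3, f4] <;> linarith
  rw [← winMass_one] at a1
  unfold crossSum
  nlinarith

/-- If few multiples of three below `K` are missing from the first color, then it has many pairs
between adjacent windows. -/
theorem crossSum_three_ge {r : ℕ → ℝ} (h0 : ∀ i, 0 ≤ r i) (h1 : ∀ i, r i ≤ 1) (l : ℕ) :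
    winMass r (3 * l) 1 * (winMass r (3 * l) 2 - 3 * mass (fun j => 1 - r (3 * j)) l) / 3
      - 3 * l ≤ crossSum r (3 * l) := by
  have q0 : ∀ i, 0 ≤ (fun j => 1 - r (3 * j)) i := fun i => by linarith [h1 (3 * i)]
  have := crossSum_ge_mul h0 (3 * l)
    -- The first window has about (K - z)/3 - s red multiples above z. The third has at least w2 - t
    -- red points up to z, where t, the tail mass of its last K - z points, is at most K - z and w2;
    -- so the total is at least about w2/3 - s.
    (winMass r (3 * l) 2 / 3 - mass (fun j => 1 - r (3 * j)) l - 1) (fun z hz => by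
      rw [mem_Ioc] at hz
      set z' := (z + 2) / 3 with hz'
      have a1 := mass_dilate_sub_le h0 (by omega : z' ≤ l)
      have a2 := mass_mono h0 (by omega : z ≤ 3 * z')
      have c1 := mass_compl (fun j => r (3 * j)) l
      have c2 := mass_compl (fun j => r (3 * j)) z'
      have c3 := mass_nonneg q0 z'
      have t1 := tail_sub_window h0 h1 2 (Nat.sub_le (3 * l) z)
      have t4 := tail_le h1 (n := 3 * (3 * l)) (k := 3 * l - z) (by omega)
      rw [Nat.cast_sub hz.2] at t4
      rw [crossMass_eq r hz.2, ← mass_window_zero]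
      have a6 : (3 * z' : ℝ) ≤ z + 2 := by
        have : 3 * z' ≤ z + 2 := by omega
        exact_mod_cast this
      norm_num at t1
      push_cast at t4
      linarith [t1.2])
  have w := winMass_le h1 (3 * l) 1
  push_cast at w
  linarith

theorem mass_three (r : ℕ → ℝ) (K : ℕ) :
    mass r (3 * K) = winMass r K 0 + winMass r K 1 + winMass r K 2 := by
  rw [mass_mul]
  simp [Finset.sum_range_succ]

/-! ### a = 3: estimates of the loss from negative gaps. -/

/-- The gap bounded from both ends of the window. -/
theorem gap_three_ge_tent {r : ℕ → ℝ} (h0 : ∀ i, 0 ≤ r i) (h1 : ∀ i, r i ≤ 1) {K k : ℕ}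
    (hk : k ≤ K) :
    |(k : ℝ) - (K - (winMass r K 0 + winMass r K 2) / 2)| -
      (3 / 2 * (winMass r K 0 + winMass r K 2) + 2 * winMass r K 1 - 2 * K) ≤
      gap r (3 * K) k := by
  have t1 := mass_sub_window h0 h1 hk
  have t2 := tail_sub_window h0 h1 2 hk
  have t3 := mass_nonneg h0 k
  have t4 := tail_nonneg h0 (3 * K) k
  norm_num at t2
  rw [gap_eq, mass_three]
  push_cast
  rcases abs_cases ((k : ℝ) - (K - (winMass r K 0 + winMass r K 2) / 2)) with ⟨e, _⟩ | ⟨e, _⟩ <;>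
    rw [e] <;> linarith

/-- One step in k adds to the head and tail masses something in [0, 1] each and subtracts 1. -/
theorem gap_lipschitz {r : ℕ → ℝ} (h0 : ∀ i, 0 ≤ r i) (h1 : ∀ i, r i ≤ 1) {n j k : ℕ}
    (hj : j ≤ n) : gap r n j - |(k : ℝ) - j| ≤ gap r n k := by
  rw [gap_eq, gap_eq]
  rcases le_total j k with h | h
  · have a1 := mass_mono h0 h
    have a2 := tail_mono h0 n h
    have : (j : ℝ) ≤ k := by exact_mod_cast h
    rw [abs_of_nonneg (by linarith)]
    linarith
  · have a1 := mass_sub_le h1 h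
    have a2 := tail_sub_le h1 h hj
    have : (k : ℝ) ≤ j := by exact_mod_cast h
    rw [abs_of_nonpos (by linarith)]
    linarith

/-- The bound that uses the missing multiples of three up to `l` and the others separately. -/
theorem colorSum_three_ge_split (r : ℕ → ℝ) (h0 : ∀ i, 0 ≤ r i) (h1 : ∀ i, r i ≤ 1) (l : ℕ)
    (w0 w1 w2 s y : ℝ) (hw0 : w0 = winMass r (3 * l) 0) (hw1 : w1 = winMass r (3 * l) 1)
    (hw2 : w2 = winMass r (3 * l) 2) (hs : s = mass (fun j => 1 - r (3 * j)) l)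
    (hy : y = mass (fun j => 1 - r (3 * j)) (3 * l) - s) :
    (w0 ^ 2 + w1 ^ 2 + w2 ^ 2) / 2 + crossSum r (3 * l) +
      s * (9 * l - 2 * (w0 + w1 + w2) - l) + s ^ 2 / 2 -
      (3 / 2 * (w0 + w2) + 2 * w1 - 6 * l) * y + y ^ 2 / 4 - 15 * l ≤
      colorSum r 3 (3 * (3 * l)) (3 * l) := by
  rw [colorSum_eq r 3 _ _ (Nat.le_mul_of_pos_left _ (by norm_num))]
  have b1 := pairSum_three_windows_ge r h0 h1 (3 * l)
  have hl : (0 : ℝ) ≤ l := Nat.cast_nonneg l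
  set q : ℕ → ℝ := fun j => 1 - r (3 * j) with hq
  have q0 : ∀ i, 0 ≤ q i := fun i => by simp only [hq]; linarith [h1 (3 * i)]
  have q1 : ∀ i, q i ≤ 1 := fun i => by simp only [hq]; linarith [h0 (3 * i)]
  have s0 : 0 ≤ s := hs ▸ mass_nonneg q0 l
  have split : ∑ k ∈ Ioc 0 (3 * l), q k * gap r (3 * (3 * l)) k =
      ∑ k ∈ Ioc 0 l, q k * gap r (3 * (3 * l)) k +
      ∑ k ∈ Ioc l (3 * l), q k * gap r (3 * (3 * l)) k :=
    (Finset.sum_Ioc_consecutive _ (Nat.zero_le l) (by omega)).symm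
  have low : s * (9 * l - 2 * (w0 + w1 + w2) - l) + s ^ 2 / 2 - l / 2 ≤
      ∑ k ∈ Ioc 0 l, q k * gap r (3 * (3 * l)) k := by
    have c1 := le_sum_weighted (Ioc 0 l) q (fun k => (l : ℝ) - k) (fun i _ => q0 i)
      (fun i _ => q1 i) s
    have c2 := sum_ramp_up_le s s0 l
    have c3 : (9 * l - 2 * (w0 + w1 + w2) - l) * ∑ i ∈ Ioc 0 l, q i +
        ∑ i ∈ Ioc 0 l, q i * ((l : ℝ) - i) ≤ ∑ k ∈ Ioc 0 l, q k * gap r (3 * (3 * l)) k := by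
      rw [Finset.mul_sum, ← Finset.sum_add_distrib]
      refine Finset.sum_le_sum fun k hk => ?_
      have : 9 * l - 2 * (w0 + w1 + w2) - k ≤ gap r (3 * (3 * l)) k := by
        rw [gap_eq, mass_three, ← hw0, ← hw1, ← hw2]
        push_cast
        linarith [mass_nonneg h0 k, tail_nonneg h0 (3 * (3 * l)) k]
      have := mul_le_mul_of_nonneg_left this (q0 k)
      linarith
    have e : ∑ i ∈ Ioc 0 l, q i = s := hs.symm
    rw [e] at c1 c3
    linarith
  have high : y ^ 2 / 4 - (3 / 2 * (w0 + w2) + 2 * w1 - 6 * l) * y - 6 * l ≤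
      ∑ k ∈ Ioc l (3 * l), q k * gap r (3 * (3 * l)) k := by
    have c1 := sum_weighted_abs_ge q (Ioc l (3 * l)) (3 * l) (Ioc_subset_Ioc_left (Nat.zero_le l))
      q0 q1 (3 * l - (w0 + w2) / 2)
    have c3 : ∑ k ∈ Ioc l (3 * l), q k * |(k : ℝ) - (3 * l - (w0 + w2) / 2)| -
        (3 / 2 * (w0 + w2) + 2 * w1 - 6 * l) * ∑ i ∈ Ioc l (3 * l), q i ≤
        ∑ k ∈ Ioc l (3 * l), q k * gap r (3 * (3 * l)) k := by
      rw [Finset.mul_sum, ← Finset.sum_sub_distrib]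
      refine Finset.sum_le_sum fun k hk => ?_
      rw [mem_Ioc] at hk
      have g := gap_three_ge_tent h0 h1 hk.2
      rw [← hw0, ← hw1, ← hw2] at g
      push_cast at g
      have := mul_le_mul_of_nonneg_left g (q0 k)
      linarith
    have e : ∑ i ∈ Ioc l (3 * l), q i = y := by
      rw [hy, hs, mass_sub q (by omega)]
    rw [e] at c1 c3
    push_cast at c1
    linarith
  rw [split]
  rw [← hw0, ← hw1, ← hw2] at b1
  push_cast at b1
  linarith

/-- The value of the gap at one point bounds both the loss from negative gaps and, in terms of the
same parameter `η`, the number of pairs between adjacent windows. -/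
theorem exists_gap_parameter (r : ℕ → ℝ) (h0 : ∀ i, 0 ≤ r i) (h1 : ∀ i, r i ≤ 1) (K : ℕ)
    (hK : 0 < K) (w0 w1 w2 : ℝ) (hw0 : w0 = winMass r K 0) (hw1 : w1 = winMass r K 1)
    (hw2 : w2 = winMass r K 2) :
    ∃ η N : ℝ, N ≤ max 0 η ^ 2 / 2 + 30 * K ∧
      N ≤ max 0 (3 / 2 * (w0 + w2) + 2 * w1 - 2 * K) ^ 2 + 2 * K ∧
      w1 * (η + 4 * K - 2 * (w0 + w2) - 4 * w1) - (w0 + w2) ^ 2 / 4 - 5 * K ≤ crossSum r K ∧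
      (w0 ^ 2 + w1 ^ 2 + w2 ^ 2) / 2 + crossSum r K - N - 2 * K ≤
        colorSum r 3 (3 * K) K := by
  have K1 : (1 : ℝ) ≤ K := by exact_mod_cast hK
  have w00 : 0 ≤ w0 := hw0 ▸ winMass_nonneg h0 K 0
  have w20 : 0 ≤ w2 := hw2 ▸ winMass_nonneg h0 K 2
  have w10 : 0 ≤ w1 := hw1 ▸ winMass_nonneg h0 K 1
  have w01 : w0 ≤ K := hw0 ▸ winMass_le h1 K 0
  have w21 : w2 ≤ K := hw2 ▸ winMass_le h1 K 2
  have w11 : w1 ≤ K := hw1 ▸ winMass_le h1 K 1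
  set c : ℝ := K - (w0 + w2) / 2 with hc
  set Λ : ℝ := 3 / 2 * (w0 + w2) + 2 * w1 - 2 * K with hΛ
  have c0 : 0 ≤ c := by linarith
  set m := ⌊c⌋₊ with hm
  have mc : (m : ℝ) ≤ c := Nat.floor_le c0
  have cm : c < m + 1 := Nat.lt_floor_add_one c
  have mK : m ≤ K := by
    have : (m : ℝ) ≤ K := by linarith
    exact_mod_cast this
  have g0 : ∀ k ∈ Ioc 0 K, |(k : ℝ) - c| - Λ ≤ gap r (3 * K) k := by
    intro k hk
    have := gap_three_ge_tent h0 h1 (mem_Ioc.1 hk).2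
    rwa [← hw0, ← hw1, ← hw2] at this
  -- `m` is the rounded center of the tent in `gap_three_ge_tent`. So `η` measures how far the
  -- actual gap at the center lies below `Λ`.
  set η := Λ - gap r (3 * K) m with hη
  have ηK : η ≤ 6 * K := by
    have t1 := mass_nonneg h0 m
    have t2 := tail_nonneg h0 (3 * K) m
    rw [hη, gap_eq, mass_three, ← hw0, ← hw1, ← hw2]
    push_cast
    linarith
  refine ⟨η, ∑ k ∈ Ioc 0 K, max 0 (-gap r (3 * K) k), ?_, ?_, ?_, ?_⟩
  · set h := max 0 η / 2 + 1 with hh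
    -- With t = k - c, the tent bound gives -gap ≤ Λ - |t| and the Lipschitz bound gives -gap ≤ η -
    -- Λ + |t|. Their minimum is a pair of tents of height η/2 at t = ±d, of total area η²/2; the 1
    -- added in `h` absorbs the rounding of c.
    set d := (2 * Λ - η) / 2 with hd
    have h0' := le_max_left 0 η
    have h1' := le_max_right 0 η
    have b1 := sum_tent_le (c + d) h (by linarith) K
    have b2 := sum_tent_le (c - d) h (by linarith) K
    have b3 : ∑ k ∈ Ioc 0 K, max 0 (-gap r (3 * K) k) ≤ ∑ k ∈ Ioc 0 K,
        (max 0 (h - |(k : ℝ) - (c + d)|) + max 0 (h - |(k : ℝ) - (c - d)|)) := by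
      refine Finset.sum_le_sum fun k hk => ?_
      have f1 := g0 k hk
      have f2 := gap_lipschitz h0 h1 (n := 3 * K) (j := m) (k := k) (by omega)
      have f3 : |(k : ℝ) - m| ≤ |(k : ℝ) - c| + 1 := by
        have := abs_sub_le (k : ℝ) c m
        have e : |c - m| ≤ 1 := by rw [abs_le]; constructor <;> linarith
        linarith
      have f4 : gap r (3 * K) m = Λ - η := by rw [hη]; ring
      have n1 := le_max_left 0 (h - |(k : ℝ) - (c + d)|)
      have n2 := le_max_left 0 (h - |(k : ℝ) - (c - d)|)
      have n3 := le_max_right 0 (h - |(k : ℝ) - (c + d)|)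
      have n4 := le_max_right 0 (h - |(k : ℝ) - (c - d)|)
      refine max_le (by linarith) ?_
      rcases abs_cases ((k : ℝ) - c) with ⟨e1, f5⟩ | ⟨e1, f5⟩
      · have : |(k : ℝ) - (c + d)| ≤ h + gap r (3 * K) k := by
          rw [abs_le]; constructor <;> linarith
        linarith
      · have : |(k : ℝ) - (c - d)| ≤ h + gap r (3 * K) k := by
          rw [abs_le]; constructor <;> linarith
        linarith
    rw [Finset.sum_add_distrib] at b3
    have ηK' : max 0 η ≤ 6 * K := max_le (by linarith) ηK
    nlinarith
  · have b := sum_tent_le c (max 0 Λ) (le_max_left _ _) K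
    refine le_trans (Finset.sum_le_sum fun k hk => max_le_max le_rfl ?_) b
    have := g0 k hk
    have := le_max_right 0 Λ
    linarith
  · have b1 := sum_tail_ramp_le c c0 K
    have b2 := sum_ramp_down_le (K - c) (by linarith) K
    have b3 : (η + 4 * K - 2 * (w0 + w2) - 4 * w1 - 2) * winMass r K 1 -
        (∑ k ∈ Ioc 0 K, max 0 ((k : ℝ) - c) + ∑ k ∈ Ioc 0 K, max 0 (K - c - (k : ℝ))) ≤
        crossSum r K := by
      rw [winMass_one, Finset.mul_sum, ← Finset.sum_add_distrib, ← Finset.sum_sub_distrib]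
      refine Finset.sum_le_sum fun z hz => ?_
      rw [mem_Ioc] at hz
      have e1 : mass r z ≤ mass r m + max 0 ((z : ℝ) - c) + 1 := by
        rcases le_total z m with h | h
        · linarith [mass_mono h0 h, le_max_left 0 ((z : ℝ) - c)]
        · linarith [mass_sub_le h1 h, le_max_right 0 ((z : ℝ) - c)]
      have e2 : tail r (3 * K) (K - z) ≤ tail r (3 * K) m + max 0 (K - c - (z : ℝ)) + 1 := by
        rcases le_total (K - z) m with h | h
        · linarith [tail_mono h0 (3 * K) h, le_max_left 0 (K - c - (z : ℝ))]
        · have := tail_sub_le h1 (n := 3 * K) h (by omega)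
          rw [Nat.cast_sub hz.2] at this
          linarith [le_max_right 0 (K - c - (z : ℝ))]
      -- The gap at `m` fixes the head and tail masses there: a larger `η` means less red at the two
      -- ends, hence more within reach of the middle window.
      have e3 : mass r m + tail r (3 * K) m = Λ - η - (3 * K - 2 * (w0 + w1 + w2)) + m := by
        have : gap r (3 * K) m = Λ - η := by rw [hη]; ring
        rw [gap_eq, mass_three, ← hw0, ← hw1, ← hw2] at this
        push_cast at this
        linarith
      have e4 : η + 4 * K - 2 * (w0 + w2) - 4 * w1 - 2 -
          (max 0 ((z : ℝ) - c) + max 0 (K - c - (z : ℝ))) ≤ crossMass r K z := by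
        rw [crossMass_eq r hz.2, ← hw0, ← hw2]
        linarith
      have e5 := le_max_left 0 ((z : ℝ) - c)
      have e6 := le_max_left 0 (K - c - (z : ℝ))
      have r0 := h0 (K + z)
      have r1 := h1 (K + z)
      nlinarith
    rw [← hw1] at b3
    have m1 : max 0 ((K : ℝ) - c) ^ 2 = (K - c) ^ 2 := by
      rw [max_eq_right (by linarith)]
    rw [m1] at b1
    have e : (K : ℝ) - c = (w0 + w2) / 2 := by rw [hc]; ring
    rw [e] at b1 b2
    rw [e] at b3
    nlinarith
  · rw [colorSum_eq r 3 _ _ (Nat.le_mul_of_pos_left _ (by norm_num))]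
    have b1 := pairSum_three_windows_ge r h0 h1 K
    have b3 := sum_mul_ge_neg (Ioc 0 K) (fun k => 1 - r (3 * k)) (fun k => gap r (3 * K) k)
      (fun k => -gap r (3 * K) k) (fun k _ => by linarith [h1 (3 * k)])
      (fun k _ => by linarith [h0 (3 * k)]) (fun k _ => by linarith)
    rw [← hw0, ← hw1, ← hw2] at b1
    linarith

/-! ### a = 3: the symmetric bound. -/

/-- The summand is max(e, 2|P k - e/2|). The excess over e is at most twice a tent on each side of a
point m where P is about e/2, and the heights satisfy a² + b² ≤ (a + b)², with a + b about (K -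
e)/2. -/
theorem sum_abs_bridge_of_nonneg (P : ℕ → ℝ) (K : ℕ) (hK : 0 < K) (hP0 : P 0 = 0)
    (hP : ∀ j k, j ≤ k → k ≤ K → |P k - P j| ≤ (k : ℝ) - j) (he : 0 ≤ P K) :
    ∑ k ∈ Ioc 0 K, (|P k| + |P K - P k|) ≤ (K : ℝ) ^ 2 / 2 + P K ^ 2 / 2 + 12 * K := by
  set e := P K with he'
  have K1 : (1 : ℝ) ≤ K := by exact_mod_cast hK
  -- Discrete intermediate value: the first index at which P reaches e/2 overshoots by at most 1.
  obtain ⟨m, hmK, hm⟩ : ∃ m ≤ K, |P m - e / 2| ≤ 1 := by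
    classical
    have ex : ∃ k, e / 2 ≤ P k := ⟨K, by linarith⟩
    have hle : Nat.find ex ≤ K := Nat.find_min' ex (by linarith)
    have hsp := Nat.find_spec ex
    refine ⟨Nat.find ex, hle, ?_⟩
    rcases Nat.eq_zero_or_pos (Nat.find ex) with h | h
    · rw [h, hP0] at hsp
      rw [h, hP0, abs_le]
      constructor <;> linarith
    · have h1 := Nat.find_min ex (m := Nat.find ex - 1) (by omega)
      have h2 := (abs_le.1 (hP (Nat.find ex - 1) (Nat.find ex) (by omega) hle)).2
      rw [Nat.cast_sub (by omega)] at h2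
      push_cast at h2
      rw [not_le] at h1
      rw [abs_le]
      constructor <;> linarith
  have hm' := abs_le.1 hm
  have hmK' : (m : ℝ) ≤ K := by exact_mod_cast hmK
  set a := (m + 1 - e / 2) / 2 with ha
  set b := (K - m + 1 - e / 2) / 2 with hb
  have bd0 := abs_le.1 (hP 0 m (Nat.zero_le m) hmK)
  have bd1 := abs_le.1 (hP m K hmK le_rfl)
  have bd2 := abs_le.1 (hP 0 K (Nat.zero_le K) le_rfl)
  rw [hP0] at bd0 bd2
  push_cast at bd0 bd2
  have a0 : 0 ≤ a := by rw [ha]; linarith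
  have b0 : 0 ≤ b := by rw [hb]; linarith
  have t1 := sum_tent_le a a a0 K
  have t2 := sum_tent_le (K - b) b b0 K
  have key : ∀ k ∈ Ioc 0 K, |P k| + |e - P k| ≤
      e + 2 * max 0 (a - |(k : ℝ) - a|) + 2 * max 0 (b - |(k : ℝ) - (K - b)|) := by
    intro k hk
    rw [mem_Ioc] at hk
    have n1 := le_max_left 0 (a - |(k : ℝ) - a|)
    have n2 := le_max_left 0 (b - |(k : ℝ) - (K - b)|)
    have n3 := le_max_right 0 (a - |(k : ℝ) - a|)
    have n4 := le_max_right 0 (b - |(k : ℝ) - (K - b)|)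
    have f0 := abs_le.1 (hP 0 k (Nat.zero_le k) hk.2)
    have f1 := abs_le.1 (hP k K hk.2 le_rfl)
    rw [hP0] at f0
    push_cast at f0
    have main : ∀ x : ℝ, (P k - e / 2 ≤ x + e / 2) → (-(P k - e / 2) ≤ x + e / 2) → 0 ≤ x →
        |P k| + |e - P k| ≤ e + 2 * x := by
      intro x h1 h2 h3
      rcases abs_cases (P k) with ⟨e1, _⟩ | ⟨e1, _⟩ <;>
        rcases abs_cases (e - P k) with ⟨e2, _⟩ | ⟨e2, _⟩ <;> rw [e1, e2] <;> linarith
    rcases le_total k m with h | h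
    · have f2 := abs_le.1 (hP k m h hmK)
      refine (main (max 0 (a - |(k : ℝ) - a|)) ?_ ?_ n1).trans (by linarith) <;>
      rcases abs_cases ((k : ℝ) - a) with ⟨e1, _⟩ | ⟨e1, _⟩ <;> rw [e1] at n3 ⊢ <;>
        linarith
    · have f2 := abs_le.1 (hP m k h hk.2)
      refine (main (max 0 (b - |(k : ℝ) - (K - b)|)) ?_ ?_ n2).trans (by linarith) <;>
      rcases abs_cases ((k : ℝ) - (K - b)) with ⟨e1, _⟩ | ⟨e1, _⟩ <;> rw [e1] at n4 ⊢ <;>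
        linarith
  refine (Finset.sum_le_sum key).trans ?_
  rw [Finset.sum_add_distrib, Finset.sum_add_distrib, Finset.sum_const, Nat.card_Ioc,
    nsmul_eq_mul, Nat.sub_zero, ← Finset.mul_sum, ← Finset.mul_sum]
  have ab : a + b = (K + 2 - e) / 2 := by rw [ha, hb]; ring
  have sq : a ^ 2 + b ^ 2 ≤ ((K + 2 - e) / 2) ^ 2 := by
    rw [← ab]; nlinarith [mul_nonneg a0 b0]
  nlinarith

theorem sum_abs_bridge (P : ℕ → ℝ) (K : ℕ) (hK : 0 < K) (hP0 : P 0 = 0)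
    (hP : ∀ j k, j ≤ k → k ≤ K → |P k - P j| ≤ (k : ℝ) - j) :
    ∑ k ∈ Ioc 0 K, (|P k| + |P K - P k|) ≤ (K : ℝ) ^ 2 / 2 + P K ^ 2 / 2 + 12 * K := by
  rcases le_total 0 (P K) with h | h
  · exact sum_abs_bridge_of_nonneg P K hK hP0 hP h
  · have := sum_abs_bridge_of_nonneg (fun k => -P k) K hK (by simp [hP0]) (fun j k hj hk => by
      have := hP j k hj hk
      rw [← abs_neg] at this
      convert this using 2
      ring) (by simpa using h)
    have e : ∀ k, |-P K - -P k| = |P K - P k| := fun k => by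
      rw [← abs_neg]; congr 1; ring
    simpa only [abs_neg, e, neg_sq] using this

/-- The symmetric bound with three windows. -/
theorem colorSum_three_symm (r : ℕ → ℝ) (h0 : ∀ i, 0 ≤ r i) (h1 : ∀ i, r i ≤ 1) (K : ℕ)
    (hK : 0 < K) (w0 w1 w2 : ℝ) (hw0 : w0 = winMass r K 0) (hw1 : w1 = winMass r K 1)
    (hw2 : w2 = winMass r K 2) (hR : 2 * (w0 + w1 + w2) ≤ 3 * K) :
    3 / 8 * (K : ℝ) ^ 2 + (2 * w1 - K) ^ 2 / 8 - K * (3 * K - 2 * (w0 + w1 + w2)) / 2 - 20 * K ≤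
      colorSum r 3 (3 * K) K := by
  refine le_trans ?_ (colorSum_ge_symm r h0 h1 3 (3 * K) K (Nat.le_mul_of_pos_left _ (by norm_num)))
  have K0 : (0 : ℝ) ≤ K := Nat.cast_nonneg K
  have hR' : mass r (3 * K) = w0 + w1 + w2 := by rw [mass_three, hw0, hw1, hw2]
  have b1 := pairSum_three_windows_ge r h0 h1 K
  have b2 := pairSum_three_windows_ge (fun i => 1 - r i) (fun i => by linarith [h1 i])
    (fun i => by linarith [h0 i]) K
  rw [winMass_compl, winMass_compl, winMass_compl] at b2
  rw [← hw0, ← hw1, ← hw2] at b1 b2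
  set P : ℕ → ℝ := fun k => 2 * mass r k - k with hP
  set Q : ℕ → ℝ := fun k => 2 * tail r (3 * K) k - k with hQ
  have PK : P K = 2 * w0 - K := by simp only [hP]; rw [mass_window_zero, ← hw0]
  have QK : Q K = 2 * w2 - K := by
    have := tail_window_last r 2 K
    norm_num at this
    simp only [hQ]; rw [this, ← hw2]
  have sP := sum_abs_bridge P K hK (by simp [hP, mass_zero]) (fun j k hj hk => by
    have a1 := mass_mono h0 hj
    have a2 := mass_sub_le h1 hj
    simp only [hP]
    rw [abs_le]; constructor <;> linarith)
  have sQ := sum_abs_bridge Q K hK (by simp [hQ, tail_zero]) (fun j k hj hk => by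
    have a1 := tail_mono h0 (3 * K) hj
    have a2 := tail_sub_le h1 (n := 3 * K) hj (by omega)
    simp only [hQ]
    rw [abs_le]; constructor <;> linarith)
  rw [Finset.sum_add_distrib] at sP sQ
  have flip : ∑ z ∈ Ioc 0 K, |Q K - Q (K - z)| ≤ ∑ z ∈ Ioc 0 K, |Q K - Q z| + K := by
    have e1 : ∑ z ∈ Ioc 0 K, |Q K - Q (K - z)| = ∑ z ∈ range K, |Q K - Q z| := by
      refine Finset.sum_nbij' (fun z => K - z) (fun z => K - z) ?_ ?_ ?_ ?_ ?_
      · intro z hz; rw [mem_Ioc] at hz; rw [mem_range]; omega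
      · intro z hz; rw [mem_range] at hz; rw [mem_Ioc]; omega
      · intro z hz; rw [mem_Ioc] at hz; omega
      · intro z hz; rw [mem_range] at hz; omega
      · intro z _; rfl
    have e2 : range K ⊆ insert 0 (Ioc 0 K) := by
      intro z hz
      rw [mem_range] at hz
      rw [mem_insert, mem_Ioc]
      omega
    have e3 := Finset.sum_le_sum_of_subset_of_nonneg (f := fun z => |Q K - Q z|) e2
      (fun z _ _ => abs_nonneg _)
    rw [Finset.sum_insert (by simp)] at e3
    have e4 : |Q K - Q 0| ≤ K := by
      have w20 : 0 ≤ w2 := hw2 ▸ winMass_nonneg h0 K 2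
      have w21 : w2 ≤ K := hw2 ▸ winMass_le h1 K 2
      have : Q 0 = 0 := by simp [hQ, tail_zero]
      rw [this, QK, abs_le]
      constructor <;> linarith
    rw [e1]
    linarith
  -- In either color the middle point sees K/2 up to half the increments of P and Q. These combine
  -- with the |P k| and |Q k| from the gaps into the sums of `sum_abs_bridge`, whose squares of P K
  -- and Q K cancel those from the outer windows.
  have cross : ∑ z ∈ Ioc 0 K, ((K : ℝ) / 2 - (|P K - P z| + |Q K - Q (K - z)|) / 2) ≤
      crossSum r K + crossSum (fun i => 1 - r i) K := by
    unfold crossSum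
    rw [← Finset.sum_add_distrib]
    refine Finset.sum_le_sum fun z hz => ?_
    rw [mem_Ioc] at hz
    rw [crossMass_compl]
    have m := crossMass_eq r hz.2
    have e1 : 2 * crossMass r K z - K = (P K - P z) + (Q K - Q (K - z)) := by
      rw [m, PK, QK, hw0, hw2]
      simp only [hP, hQ]
      rw [Nat.cast_sub hz.2]
      ring
    have r0 := h0 (K + z)
    have r1 := h1 (K + z)
    have g1 := neg_abs_le (P K - P z)
    have g2 := neg_abs_le (Q K - Q (K - z))
    have g3 := le_abs_self (P K - P z)
    have g4 := le_abs_self (Q K - Q (K - z))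
    have q1 : (K : ℝ) / 2 - (|P K - P z| + |Q K - Q (K - z)|) / 2 ≤ crossMass r K z := by linarith
    have q2 : (K : ℝ) / 2 - (|P K - P z| + |Q K - Q (K - z)|) / 2 ≤ K - crossMass r K z := by
      linarith
    nlinarith
  rw [Finset.sum_sub_distrib, Finset.sum_const, Nat.card_Ioc, nsmul_eq_mul, Nat.sub_zero,
    ← Finset.sum_div, Finset.sum_add_distrib] at cross
  have gaps : ∑ k ∈ Ioc 0 K, |gap r (3 * K) k| ≤
      ∑ k ∈ Ioc 0 K, ((3 * K - 2 * (w0 + w1 + w2)) + (|P k| + |Q k|) / 2) := by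
    refine Finset.sum_le_sum fun k _ => ?_
    have := abs_gap_le r (n := 3 * K) (by rw [hR']; push_cast; exact hR) k
    rw [hR'] at this
    push_cast at this
    exact this
  rw [Finset.sum_add_distrib, Finset.sum_const, Nat.card_Ioc, nsmul_eq_mul, Nat.sub_zero,
    ← Finset.sum_div, Finset.sum_add_distrib] at gaps
  rw [PK] at sP cross
  rw [QK] at sQ cross flip
  nlinarith

/-! ### a = 3: quadratic inequalities. -/

/-- The quadratic inequality behind the case where many multiples of three have the second color. -/
theorem quadratic_of_many_missing (a b c s y X : ℝ) (ha : 0 ≤ a) (hc : 0 ≤ c)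
    (hs : 0 ≤ s) (hy : 0 ≤ y)
    (hhi : a + b + c ≤ 157 / 125) (hsy : 53 / 200 ≤ s + y) (hX0 : 0 ≤ X)
    (hX1 : b * (c - 3 * s) / 3 ≤ X)
    (hX2 : a + c ≤ 1 → 1 ≤ a + b + c → (a + b + c - 1) ^ 2 / 4 ≤ X) :
    5 / 18 ≤ (a ^ 2 + b ^ 2 + c ^ 2) / 2 + X + s * (8 / 3 - 2 * (a + b + c)) + s ^ 2 / 2
      - (3 / 2 * (a + c) + 2 * b - 2) * y + y ^ 2 / 4 := by
  -- As a function of y the expression is least at y = 3a + 4b + 3c - 4. If this lies below the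
  -- constraint y ≥ 53/200 - s, put y at the constraint; otherwise complete the square, or drop y
  -- when the minimizer is negative.
  rcases le_total (3 * a + 4 * b + 3 * c - 4) (53 / 200 - s) with h | h
  · have g : (53 / 200 - s) ^ 2 / 4 - (3 / 2 * (a + c) + 2 * b - 2) * (53 / 200 - s) ≤
        y ^ 2 / 4 - (3 / 2 * (a + c) + 2 * b - 2) * y := by
      nlinarith [mul_nonneg (by linarith : 0 ≤ y - (53 / 200 - s))
        (by linarith : 0 ≤ (y + (53 / 200 - s)) / 4 - (3 / 2 * (a + c) + 2 * b - 2))]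
    rcases le_total (a + c) 1 with hw | hw
    · rcases le_total 1 (a + b + c) with hv | hv
      · have X2 := hX2 hw hv
        -- After X is replaced by a convex combination of its lower bounds, the squares are a
        -- Lagrange reduction eliminating a, b, c, s in turn.
        linarith [sq_nonneg (a + 7 / 47 * b + 7 / 47 * c - 20 / 47 * s - 229 / 470),
          sq_nonneg (b + 1031 / 3240 * c - 541 / 1080 * s - 11651 / 21600),
          sq_nonneg (c - 47121 / 200737 * s - 1127631 / 4014740),
          sq_nonneg (s - 21191203 / 226921800)]
      · linarith [sq_nonneg (a + (-1 / 2) * s + (-119 / 400)),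
          sq_nonneg (b + (17 / 60) * c + (-17 / 20) * s + (-43 / 100)),
          sq_nonneg (c + (-933 / 3311) * s + (-3162 / 16555)),
          sq_nonneg (s + (-235087 / 3611400))]
    · linarith [sq_nonneg (a + (-1 / 2) * s + (-199 / 400)),
        sq_nonneg (b + (1 / 3) * c + (-1) * s + (-7 / 25)),
        sq_nonneg (c + (-3 / 16) * s + (-291 / 640)),
        sq_nonneg (s + (-193 / 600))]
  · rcases le_total (3 * a + 4 * b + 3 * c - 4) 0 with hL | hL
    · have t1 := mul_nonneg hy (by linarith : 0 ≤ 4 - 3 * a - 4 * b - 3 * c)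
      have t2 := mul_nonneg (by linarith : 0 ≤ s - 53 / 200)
        (by linarith : 0 ≤ 8 / 3 - 2 * (a + b + c))
      have t3 := mul_self_nonneg (a + b + c - 53 / 50)
      linarith [sq_nonneg (a - b), sq_nonneg (a - c), sq_nonneg (b - c), sq_nonneg y,
        sq_nonneg (s - 53 / 200)]
    · have g := sq_nonneg (y / 2 - (3 / 2 * (a + c) + 2 * b - 2))
      rcases le_total (a + c) 1 with hw | hw
      · rcases le_or_gt 1 (a + b + c) with hv | hv
        · have X2 := hX2 hw hv
          have p : (3 * a + 4 * b + 3 * c - 4 - (53 / 200 - s)) ^ 2 ≤ (b + s - 497 / 1000) ^ 2 :=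
            pow_le_pow_left₀ (by linarith) (by linarith) 2
          linarith [sq_nonneg (a + (13 / 53) * b + (13 / 53) * c + (-20 / 53) * s + (-61 / 106)),
            sq_nonneg (b + (1151 / 2370) * c + (-771 / 790) * s + (-6353 / 9875)),
            sq_nonneg (c + (-3429 / 152083) * s + (-1217994 / 3802075)),
            sq_nonneg (s + (-167483 / 23020500))]
        · exfalso; linarith
      · have t1 := mul_nonneg (by linarith : 0 ≤ s - 241 / 1000)
          (by linarith : 0 ≤ 8 / 3 - 2 * (a + b + c))
        have t2 := pow_le_pow_left₀ hL (by linarith : 3 * a + 4 * b + 3 * c - 4 ≤ 3 / 125) 2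
        have t3 := pow_le_pow_left₀ zero_le_one hw 2
        linarith [sq_nonneg (a - c), sq_nonneg b, sq_nonneg (s - 241 / 1000)]

theorem quadratic_of_dense_light (b v η N X : ℝ) (hv : 32 / 125 ≤ v) (hb : v ≤ b) (hb1 : b ≤ 1)
    (hr : 7 / 36 + (b - 1 / 2) ^ 2 ≤ 1 - 2 * v) (hN : N ≤ max 0 η ^ 2 / 2)
    (hN' : N ≤ ((b + 3 * v - 1) / 2) ^ 2)
    (hX : b * (η + 2 - 2 * v - 2 * b) - (1 + v - b) ^ 2 / 4 ≤ X) (hX' : v ^ 2 / 4 ≤ X) :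
    5 / 18 ≤ (1 + v - b) ^ 2 / 4 + b ^ 2 / 2 + X - N := by
  rcases le_total η 0 with h0 | h0
  · rw [max_eq_left h0] at hN
    nlinarith [sq_nonneg (b - (1 + v) / 3)]
  rw [max_eq_right h0] at hN
  rcases le_total η b with h1 | h1
  · have key : ∀ c, 0 ≤ c → 5 / 18 ≤ (1 + v - b) ^ 2 / 4 + b ^ 2 / 2 + v ^ 2 / 4 - c ^ 2 / 2 →
        5 / 18 ≤ b ^ 2 / 2 + b * (2 - 2 * v - 2 * b) + b * c - c ^ 2 / 2 →
        5 / 18 ≤ (1 + v - b) ^ 2 / 4 + b ^ 2 / 2 + X - N := by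
      intro c c0 hA hB
      rcases le_total η c with h2 | h2
      · have := pow_le_pow_left₀ h0 h2 2
        linarith
      · have := mul_nonneg (sub_nonneg.2 h2) (sub_nonneg.2 h1)
        have := sq_nonneg (η - c)
        linarith
    rcases le_total b (3 / 5) with h2 | h2
    · refine key (6 / 5 * v - 53 / 200) (by linarith) ?_ ?_
      · clear hX hX' hN hN' key h0 h1
        nlinarith [sq_nonneg (b - (1 + v) / 3)]
      · clear hX hX' hN hN' key h0 h1
        nlinarith [mul_nonneg (sub_nonneg.2 hv) (sub_nonneg.2 hb),
          mul_nonneg (sub_nonneg.2 hv) (sub_nonneg.2 h2),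
          mul_nonneg (sub_nonneg.2 hb) (sub_nonneg.2 h2)]
    · refine key (b - 19 / 50) (by linarith) ?_ ?_
      · clear hX hX' hN hN' key h0 h1
        nlinarith [sq_nonneg (b - (1 + v) / 3)]
      · clear hX hX' hN hN' key h0 h1
        nlinarith [mul_nonneg (sub_nonneg.2 hv) (sub_nonneg.2 hb),
          mul_nonneg (sub_nonneg.2 hv) (sub_nonneg.2 hb1),
          mul_nonneg (sub_nonneg.2 hr) (sub_nonneg.2 h2)]
  · have : 5 / 18 ≤ b ^ 2 / 2 + b * (2 - 2 * v - 2 * b) + b * b - ((b + 3 * v - 1) / 2) ^ 2 := by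
      clear hX hX' hN hN' h0 h1
      nlinarith [mul_nonneg (sub_nonneg.2 hv) (sub_nonneg.2 hb),
        mul_nonneg (sub_nonneg.2 hv) (sub_nonneg.2 hb1),
        mul_nonneg (sub_nonneg.2 hb) (sub_nonneg.2 hb1)]
    have := mul_nonneg (by linarith : 0 ≤ b) (sub_nonneg.2 h1)
    linarith

theorem quadratic_of_dense_heavy (b v η N X : ℝ) (hv : 32 / 125 ≤ v) (hb : b ≤ v) (hb0 : 0 ≤ b)
    (hr : 7 / 36 + (b - 1 / 2) ^ 2 ≤ 1 - 2 * v) (hN : N ≤ max 0 η ^ 2 / 2)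
    (hN' : N ≤ ((b + 3 * v - 1) / 2) ^ 2)
    (hX : b * (η + 2 - 2 * v - 2 * b) - (1 + v - b) ^ 2 / 4 ≤ X) (hX' : (v - b) * b ≤ X) :
    5 / 18 ≤ (1 + v - b) ^ 2 / 4 + b ^ 2 / 2 + X - N := by
  have hv' : v ≤ 29 / 72 := by nlinarith [sq_nonneg (b - 1 / 2)]
  rcases le_total b (33 / 100) with h | h
  · have : 5 / 18 ≤ (1 + v - b) ^ 2 / 4 + b ^ 2 / 2 + (v - b) * b - ((b + 3 * v - 1) / 2) ^ 2 := by
      clear hX hX' hN hN'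
      nlinarith [mul_nonneg (sub_nonneg.2 hv) (sub_nonneg.2 hb), mul_nonneg (sub_nonneg.2 hv) hb0,
        mul_nonneg (sub_nonneg.2 hb) hb0, mul_nonneg (sub_nonneg.2 hb) (sub_nonneg.2 hv'),
        mul_nonneg (sub_nonneg.2 h) (sub_nonneg.2 hv'), mul_nonneg (sub_nonneg.2 h) (sub_nonneg.2 hb),
        mul_nonneg (sub_nonneg.2 hv) (sub_nonneg.2 hv')]
    linarith
  have p1 := mul_nonneg (sub_nonneg.2 hv) (sub_nonneg.2 hb)
  have p2 := mul_nonneg (sub_nonneg.2 hv) (sub_nonneg.2 h)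
  have p3 := mul_nonneg (sub_nonneg.2 hb) (sub_nonneg.2 h)
  have p4 := mul_nonneg (sub_nonneg.2 hr) (sub_nonneg.2 h)
  rcases le_total η (11 / 50) with h0 | h0
  · have : max 0 η ^ 2 ≤ (11 / 50) ^ 2 :=
      pow_le_pow_left₀ (le_max_left _ _) (max_le (by norm_num) h0) 2
    nlinarith
  · rw [max_eq_right (by linarith)] at hN
    rcases le_total η b with h1 | h1
    · have : 5 / 18 ≤ b ^ 2 / 2 + b * (2 - 2 * v - 2 * b) + b * (11 / 50) - (11 / 50) ^ 2 / 2 := by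
        clear hX hX' hN hN' h0 h1
        nlinarith
      have := mul_nonneg (sub_nonneg.2 h0) (sub_nonneg.2 h1)
      have := sq_nonneg (η - 11 / 50)
      linarith
    · have : 5 / 18 ≤ b ^ 2 / 2 + b * (2 - 2 * v - 2 * b) + b * b - ((b + 3 * v - 1) / 2) ^ 2 := by
        clear hX hX' hN hN' h0 h1
        nlinarith
      have := mul_nonneg hb0 (sub_nonneg.2 h1)
      linarith

/-- The quadratic inequality behind the case where the first color is dense. -/
theorem quadratic_of_dense (a b c η N X : ℝ) (hb0 : 0 ≤ b) (hb1 : b ≤ 1)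
    (hv : 157 / 125 ≤ a + b + c)
    (hr : 7 / 36 + (b - 1 / 2) ^ 2 ≤ 3 - 2 * (a + b + c)) (hN : N ≤ max 0 η ^ 2 / 2)
    (hN' : N ≤ max 0 (3 / 2 * (a + c) + 2 * b - 2) ^ 2)
    (hX : b * (η + 4 - 2 * (a + c) - 4 * b) - (a + c) ^ 2 / 4 ≤ X)
    (hX1 : (a + c - 1) * b ≤ X)
    (hX2 : a + c ≤ 1 → 1 ≤ a + b + c → (a + b + c - 1) ^ 2 / 4 ≤ X) :
    5 / 18 ≤ (a ^ 2 + b ^ 2 + c ^ 2) / 2 + X - N := by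
  obtain ⟨v, rfl⟩ : ∃ v, a = 1 + v - b - c := ⟨a + b + c - 1, by ring⟩
  have e1 : (1 + v - b - c) + c = 1 + v - b := by ring
  have e2 : (1 + v - b - c) + b + c = 1 + v := by ring
  rw [e1] at hN' hX hX1 hX2
  rw [e2] at hv hr hX2
  have hN2 : N ≤ ((b + 3 * v - 1) / 2) ^ 2 := by
    refine hN'.trans ?_
    have e : (b + 3 * v - 1) / 2 = 3 / 2 * (1 + v - b) + 2 * b - 2 := by ring
    rw [e]
    rcases max_sq_cases (3 / 2 * (1 + v - b) + 2 * b - 2) with ⟨e, _⟩ | ⟨e, _⟩ <;> rw [e]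
    exact sq_nonneg _
  have sq := sq_nonneg ((1 + v - b - c) - c)
  rcases le_total v b with h | h
  · have := quadratic_of_dense_light b v η N X (by linarith) h hb1 (by linarith) hN hN2
      (by linarith) (by have := hX2 (by linarith) (by linarith); linarith)
    linarith
  · have := quadratic_of_dense_heavy b v η N X (by linarith) h hb0 (by linarith) hN hN2
      (by linarith) (by linarith)
    linarith

/-- The quadratic inequality behind the case where few multiples of three have the second color. -/
theorem quadratic_of_few_missing (l S V : ℝ) (hl : 0 ≤ l) (hS : 0 ≤ S) (hS' : S ≤ 159 / 200 * l)
    (hV' : V ≤ 96 / 125 * l) (hSV : 0 ≤ S + V) :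
    0 ≤ S * (l / 3 - 2 * V - S) + l * (S + V) + V ^ 2 / 6 := by
  rcases le_total 0 V with h | h
  · nlinarith [mul_nonneg hS (sub_nonneg.2 hS'), mul_nonneg (sub_nonneg.2 hS') (sub_nonneg.2 hV'),
      mul_nonneg hS (sub_nonneg.2 hV'), mul_nonneg h (sub_nonneg.2 hS'), mul_nonneg h hS,
      mul_nonneg h hl, mul_nonneg hl (sub_nonneg.2 hV'), mul_nonneg hl hS]
  · nlinarith [mul_nonneg hSV (sub_nonneg.2 hS'), mul_nonneg hSV (neg_nonneg.2 h),
      mul_nonneg (neg_nonneg.2 h) hl, mul_nonneg hSV hl, mul_nonneg (neg_nonneg.2 h) (sub_nonneg.2 hS')]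

/-! ### a = 3: the case distinction. -/

theorem lowerBound_three : LowerBound 3 := by
  refine ⟨200, fun l r h0 h1 hR => ?_⟩
  rcases Nat.eq_zero_or_pos l with rfl | hl
  · simp [colorSum]
  have l0 : (0 : ℝ) < l := by exact_mod_cast hl
  by_cases hA : 2 * mass r (3 * (3 * l)) ≤ (((3 : ℕ) : ℝ) ^ 2 - (3 : ℕ) - 1) * l
  · have := colorSum_ge_of_sparse r h0 h1 3 l (by norm_num) hA
    push_cast at this ⊢
    nlinarith
  rw [not_le] at hA
  set K : ℝ := 3 * l with hK
  have K0 : 0 < K := by rw [hK]; linarith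
  have Kc : ((3 * l : ℕ) : ℝ) = K := by push_cast; rfl
  obtain ⟨a, ha⟩ : ∃ a, a * K = winMass r (3 * l) 0 := ⟨_, div_mul_cancel₀ _ K0.ne'⟩
  obtain ⟨b, hb⟩ : ∃ b, b * K = winMass r (3 * l) 1 := ⟨_, div_mul_cancel₀ _ K0.ne'⟩
  obtain ⟨c, hc⟩ : ∃ c, c * K = winMass r (3 * l) 2 := ⟨_, div_mul_cancel₀ _ K0.ne'⟩
  have hM : mass r (3 * (3 * l)) = (a + b + c) * K := by rw [mass_three, ← ha, ← hb, ← hc]; ring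
  have pos : ∀ x : ℝ, 0 ≤ x * K → 0 ≤ x := fun x hx => nonneg_of_mul_nonneg_left hx K0
  have le1 : ∀ x y : ℝ, x * K ≤ y * K → x ≤ y := fun x y h => le_of_mul_le_mul_right h K0
  have a0 : 0 ≤ a := pos a (ha ▸ winMass_nonneg h0 _ 0)
  have b0 : 0 ≤ b := pos b (hb ▸ winMass_nonneg h0 _ 1)
  have c0 : 0 ≤ c := pos c (hc ▸ winMass_nonneg h0 _ 2)
  have b1 : b ≤ 1 := le1 _ _ (by rw [hb, one_mul, ← Kc]; exact winMass_le h1 _ 1)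
  rw [hM] at hA hR
  push_cast at hA hR ⊢
  -- All masses are measured in units of K, and the added 5K absorbs the linear errors of the lower
  -- bounds for `crossSum`.
  obtain ⟨X, hX⟩ : ∃ X, X * K ^ 2 = crossSum r (3 * l) + 5 * K :=
    ⟨_, div_mul_cancel₀ _ (pow_ne_zero 2 K0.ne')⟩
  have le2 : ∀ x y : ℝ, x * K ^ 2 ≤ y * K ^ 2 → x ≤ y :=
    fun x y h => le_of_mul_le_mul_right h (pow_pos K0 2)
  have X1 : (a + c - 1) * b ≤ X := le2 _ _ (by
    have := crossSum_ge_of_heavy h0 h1 (3 * l)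
    rw [← ha, ← hb, ← hc, Kc] at this
    rw [hX]; linarith)
  have X2 : a + c ≤ 1 → 1 ≤ a + b + c → (a + b + c - 1) ^ 2 / 4 ≤ X := fun g1 g2 => le2 _ _ (by
    have g3 := mul_le_mul_of_nonneg_right g1 K0.le
    have g4 := mul_le_mul_of_nonneg_right g2 K0.le
    have := crossSum_ge_sq h0 h1 (3 * l) (by rw [← ha, ← hc, Kc]; linarith)
      (by rw [← ha, ← hb, ← hc, Kc]; linarith)
    rw [← ha, ← hb, ← hc, Kc] at this
    rw [hX]; linarith)
  have goal_of : ∀ f E : ℝ, 5 / 18 ≤ f → f * K ^ 2 - E ≤ colorSum r 3 (3 * (3 * l)) (3 * l) →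
      E ≤ 200 * l → (2 * (3 : ℝ) - 1) / 2 * l ^ 2 - 200 * l ≤
        colorSum r 3 (3 * (3 * l)) (3 * l) := by
    intro f E hf h hE
    have := mul_le_mul_of_nonneg_right hf (pow_pos K0 2).le
    have e : (2 * (3 : ℝ) - 1) / 2 * l ^ 2 = 5 / 18 * K ^ 2 := by rw [hK]; ring
    linarith
  rcases le_total (a + b + c) (157 / 125) with hv | hv
  · set q : ℕ → ℝ := fun j => 1 - r (3 * j) with hq
    have q0 : ∀ i, 0 ≤ q i := fun i => by simp only [hq]; linarith [h1 (3 * i)]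
    rcases le_total (mass q (3 * l)) (53 / 200 * K) with hS | hS
    · obtain ⟨p1, p2, p3⟩ := colorSum_three_perturb r h0 h1 l _ _ rfl rfl
      rw [hM] at p1 p2
      have hv' := mul_le_mul_of_nonneg_right hv K0.le
      have := quadratic_of_few_missing l (mass q (3 * l)) ((a + b + c) * K - 3 * l) l0.le p3
        (by rw [hK] at hS; linarith) (by linarith) p2
      linarith
    · obtain ⟨s, hs⟩ : ∃ s, s * K = mass q l := ⟨_, div_mul_cancel₀ _ K0.ne'⟩
      obtain ⟨y, hy⟩ : ∃ y, y * K = mass q (3 * l) - mass q l := ⟨_, div_mul_cancel₀ _ K0.ne'⟩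
      have s0 : 0 ≤ s := pos s (hs ▸ mass_nonneg q0 l)
      have y0 : 0 ≤ y := pos y (by rw [hy]; linarith [mass_mono q0 (by omega : l ≤ 3 * l)])
      have main := colorSum_three_ge_split r h0 h1 l _ _ _ _ (y * K) ha hb hc hs
        (by rw [hs]; exact hy)
      have f := quadratic_of_many_missing a b c s y X a0 c0 s0 y0 hv
        (le1 _ _ (by rw [add_mul, hs, hy]; linarith)) (le2 _ _ (by
          rw [hX]; linarith [crossSum_nonneg h0 (3 * l)])) (le2 _ _ (by
          have := crossSum_three_ge h0 h1 l
          rw [← hb, ← hc, ← hs] at this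
          rw [hX, hK] at *
          linarith)) X2
      refine goal_of _ (20 * K) f ?_ (by rw [hK]; linarith)
      rw [hK] at *
      linarith
  · have hR' : 2 * ((a + b + c) * K) ≤ 3 * K := by rw [hK] at *; linarith
    -- The symmetric bound reaches 5/18 exactly when 3 - 2(a + b + c) is at most this quantity.
    rcases le_total (7 / 36 + (b - 1 / 2) ^ 2) (3 - 2 * (a + b + c)) with hD | hD
    · obtain ⟨η', N', g1, g2, g3, g4⟩ := exists_gap_parameter r h0 h1 (3 * l) (by omega) _ _ _ ha hb hc
      rw [Kc] at g1 g2 g3 g4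
      obtain ⟨η, rfl⟩ : ∃ η, η' = η * K := ⟨η' / K, (div_mul_cancel₀ _ K0.ne').symm⟩
      obtain ⟨N, hN⟩ : ∃ N, N * K ^ 2 = N' - 30 * K :=
        ⟨_, div_mul_cancel₀ _ (pow_ne_zero 2 K0.ne')⟩
      have mx : ∀ x : ℝ, max 0 (x * K) = max 0 x * K := fun x => by
        rw [max_mul_of_nonneg _ _ K0.le, zero_mul]
      have f := quadratic_of_dense a b c η N X b0 b1 hv hD (le2 _ _ (by
          rw [mx] at g1
          rw [hN]; linarith)) (le2 _ _ (by
          have e : 3 / 2 * (a * K + c * K) + 2 * (b * K) - 2 * K =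
            (3 / 2 * (a + c) + 2 * b - 2) * K := by ring
          rw [e, mx] at g2
          rw [hN]; linarith)) (le2 _ _ (by rw [hX]; linarith)) X1 X2
      refine goal_of _ (40 * K) f ?_ (by rw [hK]; linarith)
      linarith
    · have main := colorSum_three_symm r h0 h1 (3 * l) (by omega) _ _ _ ha hb hc
        (by rw [Kc]; linarith)
      rw [Kc] at main
      refine goal_of (3 / 8 + (2 * b - 1) ^ 2 / 8 - (3 - 2 * (a + b + c)) / 2) (20 * K) ?_ ?_
        (by rw [hK]; linarith)
      · linarith
      · linarith

/-! ### From weights back to colorings, and the asymptotics. -/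

/-- The indicator function of the first color. -/
noncomputable def redWeight {n : ℕ} (χ : Finset.Icc 1 n → Fin 2) (i : ℕ) : ℝ :=
  if h : i ∈ Finset.Icc 1 n then (if χ ⟨i, h⟩ = 0 then 1 else 0) else 0

theorem redWeight_nonneg {n : ℕ} (χ : Finset.Icc 1 n → Fin 2) (i : ℕ) : 0 ≤ redWeight χ i := by
  unfold redWeight; split_ifs <;> norm_num

theorem redWeight_le_one {n : ℕ} (χ : Finset.Icc 1 n → Fin 2) (i : ℕ) : redWeight χ i ≤ 1 := by
  unfold redWeight; split_ifs <;> norm_num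

theorem redWeight_mono {n : ℕ} (χ : Finset.Icc 1 n → Fin 2) (x y z : Finset.Icc 1 n) :
    redWeight χ z * (redWeight χ y * redWeight χ x) +
      (1 - redWeight χ z) * ((1 - redWeight χ y) * (1 - redWeight χ x)) =
      if χ x = χ y ∧ χ y = χ z then 1 else 0 := by
  have e : ∀ i : Finset.Icc 1 n, redWeight χ i = if χ i = 0 then 1 else 0 := fun i => by
    unfold redWeight
    rw [dif_pos i.2]
  rw [e, e, e]
  have two : ∀ c : Fin 2, c = 0 ∨ c = 1 := by decide
  rcases two (χ x) with h1 | h1 <;> rcases two (χ y) with h2 | h2 <;>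
    rcases two (χ z) with h3 | h3 <;> simp [h1, h2, h3]

theorem colorSum_le_monoCount {n : ℕ} (χ : Finset.Icc 1 n → Fin 2) (a m K : ℕ) (ha : 0 < a)
    (hm : m ≤ n) (hK : a * K ≤ n) :
    colorSum (redWeight χ) a m K ≤ (monoCount (a : ℤ) (-a) 1 χ : ℝ) := by
  classical
  set S : Finset (Σ _ : ℕ, ℕ) := (Ioc 0 K).sigma fun k => Ioc 0 (m - k) with hS
  -- `P` singles out the pairs (k, y) coming from a monochromatic solution; being an image of the
  -- solutions, they are no more numerous.
  set P : (Σ _ : ℕ, ℕ) → Prop := fun p => ∃ q ∈ monoSolutions (a : ℤ) (-a) 1 χ,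
    (⟨(q.2.2 : ℕ) / a, (q.2.1 : ℕ)⟩ : Σ _ : ℕ, ℕ) = p with hP
  have e : colorSum (redWeight χ) a m K ≤ ∑ p ∈ S, if P p then (1 : ℝ) else 0 := by
    unfold colorSum
    rw [Finset.sum_sigma']
    refine Finset.sum_le_sum fun p hp => ?_
    rw [mem_sigma, mem_Ioc, mem_Ioc] at hp
    have hak : a * p.1 ≤ a * K := Nat.mul_le_mul_left a hp.1.2
    have hak0 : 0 < a * p.1 := Nat.mul_pos ha hp.1.1
    have hx : p.2 + p.1 ∈ Finset.Icc 1 n := by rw [mem_Icc]; omega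
    have hy : p.2 ∈ Finset.Icc 1 n := by rw [mem_Icc]; omega
    have hz : a * p.1 ∈ Finset.Icc 1 n := by rw [mem_Icc]; omega
    have := redWeight_mono χ ⟨_, hx⟩ ⟨_, hy⟩ ⟨_, hz⟩
    simp only at this
    rw [this]
    by_cases h : χ ⟨_, hx⟩ = χ ⟨_, hy⟩ ∧ χ ⟨_, hy⟩ = χ ⟨_, hz⟩
    · rw [if_pos h, if_pos]
      refine ⟨(⟨_, hx⟩, ⟨_, hy⟩, ⟨_, hz⟩), ?_, ?_⟩
      · unfold monoSolutions
        rw [mem_filter]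
        refine ⟨mem_univ _, ?_, h⟩
        push_cast
        ring
      · simp only [Nat.mul_div_cancel_left _ ha]
    · rw [if_neg h]
      split_ifs <;> norm_num
  refine e.trans ?_
  rw [← Finset.sum_filter, Finset.sum_const, nsmul_eq_mul, mul_one]
  have : S.filter P ⊆ (monoSolutions (a : ℤ) (-a) 1 χ).image
      fun q => (⟨(q.2.2 : ℕ) / a, (q.2.1 : ℕ)⟩ : Σ _ : ℕ, ℕ) := by
    intro p hp
    rw [mem_filter] at hp
    rw [mem_image]
    exact hp.2
  exact_mod_cast (card_le_card this).trans card_image_le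

theorem sq_floor_ge (n b : ℕ) (hb : 0 < b) :
    ((n : ℝ) / b) ^ 2 - 2 * ((n : ℝ) / b) ≤ ((n / b : ℕ) : ℝ) ^ 2 := by
  have hb' : (0 : ℝ) < b := by exact_mod_cast hb
  have h1 : (n : ℝ) / b < (n / b : ℕ) + 1 := by
    rw [div_lt_iff₀ hb']
    have : n < (n / b + 1) * b := by rw [mul_comm]; exact Nat.lt_mul_div_succ n hb
    exact_mod_cast this
  have h2 : (0 : ℝ) ≤ (n / b : ℕ) := Nat.cast_nonneg _
  have h3 : (0 : ℝ) ≤ (n : ℝ) / b := by positivity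
  rcases le_total ((n : ℝ) / b) 1 with h | h
  · nlinarith [mul_nonneg h3 (sub_nonneg.2 h)]
  · have : ((n : ℝ) / b - 1) ^ 2 ≤ ((n / b : ℕ) : ℝ) ^ 2 :=
      pow_le_pow_left₀ (by linarith) (by linarith) 2
    linarith

theorem minMonoCount_ge (a : ℕ) (ha : 0 < a) (h : LowerBound a) :
    ∃ C : ℝ, ∀ n : ℕ, (2 * (a : ℝ) - 1) * (n : ℝ) ^ 2 / (2 * (a : ℝ) ^ 4) - C * n ≤
      (minMonoCount a (-a) 1 n 2 : ℝ) := by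
  obtain ⟨C, hC⟩ := h
  have a1 : (1 : ℝ) ≤ a := by exact_mod_cast ha
  refine ⟨|C| + (2 * a - 1), fun n => ?_⟩
  obtain ⟨χ, hχ⟩ : ∃ χ, monoCount a (-a) 1 χ = minMonoCount a (-a) 1 n 2 :=
    Nat.sInf_mem (Set.range_nonempty _)
  rw [← hχ]
  set l := n / a ^ 2 with hl
  have hln : a * (a * l) ≤ n := by
    have := Nat.mul_div_le n (a ^ 2)
    rwa [sq, mul_assoc, ← sq, ← hl] at this
  have hcount := colorSum_le_monoCount χ a (a * (a * l)) (a * l) ha hln hln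
  have hlow : (2 * (a : ℝ) - 1) / 2 * l ^ 2 - C * l ≤
      colorSum (redWeight χ) a (a * (a * l)) (a * l) := by
    rcases le_total (2 * mass (redWeight χ) (a * (a * l))) ((a : ℝ) ^ 2 * l) with hR | hR
    · exact hC l _ (redWeight_nonneg χ) (redWeight_le_one χ) hR
    · rw [← colorSum_compl]
      refine hC l _ (fun i => by linarith [redWeight_le_one χ i])
        (fun i => by linarith [redWeight_nonneg χ i]) ?_
      rw [mass_compl]
      push_cast
      linarith
  have hsq := sq_floor_ge n (a ^ 2) (by positivity)
  rw [← hl] at hsq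
  push_cast at hsq
  have hln' : (l : ℝ) ≤ n := by exact_mod_cast Nat.div_le_self n (a ^ 2)
  have hCl : C * l ≤ |C| * n :=
    (mul_le_mul_of_nonneg_right (le_abs_self C) (Nat.cast_nonneg l)).trans
      (mul_le_mul_of_nonneg_left hln' (abs_nonneg C))
  have hdiv : (n : ℝ) / a ^ 2 ≤ n := div_le_self (Nat.cast_nonneg n) (one_le_pow₀ a1)
  have e : (2 * (a : ℝ) - 1) * (n : ℝ) ^ 2 / (2 * (a : ℝ) ^ 4) =
      (2 * (a : ℝ) - 1) / 2 * ((n : ℝ) / a ^ 2) ^ 2 := by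
    field_simp
  rw [e]
  have f := mul_le_mul_of_nonneg_left hsq (by linarith : (0 : ℝ) ≤ (2 * (a : ℝ) - 1) / 2)
  have f' := mul_le_mul_of_nonneg_left hdiv (by linarith : (0 : ℝ) ≤ 2 * (a : ℝ) - 1)
  linarith

theorem minMonoCount_le (a n : ℕ) (χ : Finset.Icc 1 n → Fin 2) :
    minMonoCount a (-a) 1 n 2 ≤ monoCount a (-a) 1 χ :=
  Nat.sInf_le ⟨χ, rfl⟩

/-- The monochromatic solutions of the coloring by multiples of `a` consist of multiples of `a`. -/
theorem monoCount_multiplesColoring_le (a n : ℕ) (ha : 0 < a) :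
    (monoCount a (-a) 1 (multiplesColoring a n) : ℝ) ≤
      (2 * (a : ℝ) - 1) * (n : ℝ) ^ 2 / (2 * (a : ℝ) ^ 4) + n := by
  have a1 : (1 : ℝ) ≤ a := by exact_mod_cast ha
  set S : Finset (Σ _ : ℕ, ℕ) := (Ioc 0 (n / a ^ 2)).sigma fun k => Ioc 0 (n / a - k) with hS
  have col : ∀ i : Finset.Icc 1 n, multiplesColoring a n i = 0 ↔ a ∣ (i : ℕ) := by
    intro i
    unfold multiplesColoring
    split_ifs with h <;> simp [h]
  have structure_of : ∀ q ∈ monoSolutions (a : ℤ) (-a) 1 (multiplesColoring a n), ∃ d y : ℕ,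
      (q.1 : ℕ) = a * (y + d) ∧ (q.2.1 : ℕ) = a * y ∧ (q.2.2 : ℕ) = a * (a * d) := by
    rintro ⟨x, y, z⟩ hq
    unfold monoSolutions at hq
    rw [mem_filter] at hq
    obtain ⟨-, heq, h1, h2⟩ := hq
    simp only at heq h1 h2 ⊢
    have hz0 := (mem_Icc.1 z.2).1
    have hz : ((z : ℕ) : ℤ) = a * ((x : ℕ) - (y : ℕ) : ℤ) := by linarith
    -- The equation makes z a multiple of a, hence red, so no blue solution exists and x and y are
    -- multiples as well.
    have hzd : a ∣ (z : ℕ) := by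
      have : (a : ℤ) ∣ ((z : ℕ) : ℤ) := ⟨_, hz⟩
      exact_mod_cast this
    have hyd : a ∣ (y : ℕ) := (col y).1 (h2.trans ((col z).2 hzd))
    have hxd : a ∣ (x : ℕ) := (col x).1 (h1.trans ((col y).2 hyd))
    obtain ⟨y', hy'⟩ := hyd
    obtain ⟨x', hx'⟩ := hxd
    have hxy : y' ≤ x' := by
      by_contra hlt
      rw [not_le] at hlt
      have h3 : ((z : ℕ) : ℤ) ≤ 0 := by
        rw [hz, hx', hy']
        push_cast
        have : (x' : ℤ) ≤ y' := by exact_mod_cast hlt.le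
        have ha' : (0 : ℤ) ≤ a := by positivity
        nlinarith [mul_nonneg ha' (mul_nonneg ha' (sub_nonneg.2 this))]
      omega
    refine ⟨x' - y', y', ?_, hy', ?_⟩
    · rw [hx', Nat.add_sub_cancel' hxy]
    · have : ((z : ℕ) : ℤ) = ((a * (a * (x' - y')) : ℕ) : ℤ) := by
        rw [hz, hx', hy']
        push_cast [Nat.cast_sub hxy]
        ring
      exact_mod_cast this
  have card : monoCount (a : ℤ) (-a) 1 (multiplesColoring a n) ≤ #S := by
    unfold monoCount
    refine card_le_card_of_injOn
      (fun q => (⟨(q.2.2 : ℕ) / a ^ 2, (q.2.1 : ℕ) / a⟩ : Σ _ : ℕ, ℕ)) ?_ ?_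
    · intro q hq
      obtain ⟨d, y, hx, hy, hz⟩ := structure_of q hq
      have b1 := mem_Icc.1 q.1.2
      have b2 := mem_Icc.1 q.2.1.2
      have b3 := mem_Icc.1 q.2.2.2
      rw [hx] at b1
      rw [hy] at b2
      rw [hz] at b3
      have e1 : a * (a * d) / a ^ 2 = d := by
        rw [← mul_assoc, ← sq]
        exact Nat.mul_div_cancel_left d (by positivity)
      have e2 : a * y / a = y := Nat.mul_div_cancel_left y ha
      have d0 : 0 < d := Nat.pos_of_ne_zero fun h => by simp [h] at b3
      have y0 : 0 < y := Nat.pos_of_ne_zero fun h => by simp [h] at b2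
      have b4 : d ≤ n / a ^ 2 := by
        rw [Nat.le_div_iff_mul_le (by positivity)]
        calc d * a ^ 2 = a * (a * d) := by ring
          _ ≤ n := b3.2
      have b5 : y + d ≤ n / a := by
        rw [Nat.le_div_iff_mul_le ha, mul_comm]
        exact b1.2
      simp only [hS, coe_sigma, Set.mem_sigma_iff, mem_coe, mem_Ioc, hy, hz, e1, e2]
      omega
    · intro q hq q' hq' h
      obtain ⟨d, y, hx, hy, hz⟩ := structure_of q hq
      obtain ⟨d', y', hx', hy', hz'⟩ := structure_of q' hq'
      have e1 : ∀ d, a * (a * d) / a ^ 2 = d := fun d => by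
        rw [← mul_assoc, ← sq]
        exact Nat.mul_div_cancel_left d (by positivity)
      have e2 : ∀ y, a * y / a = y := fun y => Nat.mul_div_cancel_left y ha
      simp only [hy, hz, hy', hz', e1, e2, Sigma.mk.injEq, heq_eq_eq] at h
      obtain ⟨rfl, rfl⟩ := h
      refine Prod.ext (Subtype.ext (hx.trans hx'.symm))
        (Prod.ext (Subtype.ext (hy.trans hy'.symm)) (Subtype.ext (hz.trans hz'.symm)))
  have hD : n / a ^ 2 ≤ n / a := Nat.div_le_div_left (Nat.le_self_pow two_ne_zero a) ha
  have cardS : (#S : ℝ) = ((n / a : ℕ) : ℝ) * (n / a ^ 2 : ℕ) -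
      (n / a ^ 2 : ℕ) * ((n / a ^ 2 : ℕ) + 1) / 2 := by
    rw [← pairSum_one _ _ hD, hS, card_sigma]
    unfold pairSum
    push_cast
    refine Finset.sum_congr rfl fun k _ => ?_
    simp
  have hsq := sq_floor_ge n (a ^ 2) (by positivity)
  have h1 : ((n / a : ℕ) : ℝ) ≤ n / a := Nat.cast_div_le
  have h2 : ((n / a ^ 2 : ℕ) : ℝ) ≤ n / (a ^ 2 : ℕ) := Nat.cast_div_le
  have h3 := mul_le_mul h1 h2 (Nat.cast_nonneg _) (by positivity)
  push_cast at hsq h2 h3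
  have hdiv : (n : ℝ) / a ^ 2 ≤ n := div_le_self (Nat.cast_nonneg n) (one_le_pow₀ a1)
  have e : (2 * (a : ℝ) - 1) * (n : ℝ) ^ 2 / (2 * (a : ℝ) ^ 4) =
      n / a * (n / a ^ 2) - (n / a ^ 2) ^ 2 / 2 := by
    field_simp
  have hc : (monoCount (a : ℤ) (-a) 1 (multiplesColoring a n) : ℝ) ≤ #S := by exact_mod_cast card
  have h4 : (0 : ℝ) ≤ (n / a ^ 2 : ℕ) := Nat.cast_nonneg _
  rw [e]
  linarith

theorem isEquivalent_of_linear_error (f : ℕ → ℝ) (c C : ℝ) (hc : 0 < c)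
    (hf : ∀ n : ℕ, |f n - c * (n : ℝ) ^ 2| ≤ C * n) :
    Asymptotics.IsEquivalent Filter.atTop f (fun n : ℕ => c * (n : ℝ) ^ 2) := by
  unfold Asymptotics.IsEquivalent
  rw [Asymptotics.isLittleO_iff]
  intro ε hε
  filter_upwards [Filter.eventually_ge_atTop ⌈C / (ε * c)⌉₊] with n hn
  have h1 : C / (ε * c) ≤ n := Nat.ceil_le.1 hn
  rw [div_le_iff₀ (by positivity)] at h1
  have h2 := hf n
  have h3 := mul_le_mul_of_nonneg_right h1 (Nat.cast_nonneg (α := ℝ) n)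
  rw [Pi.sub_apply, Real.norm_eq_abs, Real.norm_eq_abs,
    abs_of_nonneg (by positivity : 0 ≤ c * (n : ℝ) ^ 2)]
  linarith

theorem lowerBound_of_mem (a : ℕ) (ha3 : 3 ≤ a) (ha7 : a ≤ 7) : LowerBound a := by
  interval_cases a
  · exact lowerBound_three
  · exact lowerBound_four
  · exact lowerBound_five
  · exact lowerBound_six
  · exact lowerBound_seven

end RadoCount

theorem theorem5 (a : ℕ) (ha3 : 3 ≤ a) (ha7 : a ≤ 7) :
    (∃ C : ℝ, ∀ n : ℕ, radoNumber a (-a) 1 2 ≤ n →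
      (2 * (a : ℝ) - 1) * (n : ℝ) ^ 2 / (2 * (a : ℝ) ^ 4) - C * n ≤
        (minMonoCount a (-a) 1 n 2 : ℝ)) ∧
    Asymptotics.IsEquivalent Filter.atTop
      (fun n : ℕ => (minMonoCount a (-a) 1 n 2 : ℝ))
      (fun n : ℕ => (2 * (a : ℝ) - 1) * (n : ℝ) ^ 2 / (2 * (a : ℝ) ^ 4)) ∧
    Asymptotics.IsEquivalent Filter.atTop
      (fun n : ℕ => (monoCount a (-a) 1 (multiplesColoring a n) : ℝ))
      (fun n : ℕ => (minMonoCount a (-a) 1 n 2 : ℝ)) := by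
  have ha : 0 < a := by omega
  have a1 : (1 : ℝ) ≤ a := by exact_mod_cast ha
  obtain ⟨C, hC⟩ := RadoCount.minMonoCount_ge a ha (RadoCount.lowerBound_of_mem a ha3 ha7)
  have hU := fun n => RadoCount.monoCount_multiplesColoring_le a n ha
  have hM : ∀ n, (minMonoCount a (-a) 1 n 2 : ℝ) ≤
      (monoCount a (-a) 1 (multiplesColoring a n) : ℝ) := fun n => by
    exact_mod_cast RadoCount.minMonoCount_le a n (multiplesColoring a n)
  have hc : 0 < (2 * (a : ℝ) - 1) / (2 * (a : ℝ) ^ 4) := by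
    apply div_pos <;> [linarith; positivity]
  have e : ∀ n : ℕ, (2 * (a : ℝ) - 1) * (n : ℝ) ^ 2 / (2 * (a : ℝ) ^ 4) =
      (2 * (a : ℝ) - 1) / (2 * (a : ℝ) ^ 4) * (n : ℝ) ^ 2 := fun n => by ring
  -- The minimum and the count of the explicit coloring are both squeezed between the same quadratic
  -- term with linear errors, so one argument serves both.
  have err : ∀ f : ℕ → ℝ, (∀ n, (minMonoCount a (-a) 1 n 2 : ℝ) ≤ f n) →
      (∀ n, f n ≤ (monoCount a (-a) 1 (multiplesColoring a n) : ℝ)) →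
      Asymptotics.IsEquivalent Filter.atTop f
        (fun n : ℕ => (2 * (a : ℝ) - 1) * (n : ℝ) ^ 2 / (2 * (a : ℝ) ^ 4)) := by
    intro f h1 h2
    simp only [e]
    refine RadoCount.isEquivalent_of_linear_error f _ (max C 1) hc fun n => ?_
    have n0 : (0 : ℝ) ≤ n := Nat.cast_nonneg n
    have m1 := mul_le_mul_of_nonneg_right (le_max_left C 1) n0
    have m2 := mul_le_mul_of_nonneg_right (le_max_right C 1) n0
    rw [← e, abs_le]
    constructor <;> linarith [h1 n, h2 n, hC n, hU n]
  have h1 := err _ (fun n => le_rfl) hM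
  have h2 := err _ hM (fun n => le_rfl)
  exact ⟨⟨C, fun n _ => hC n⟩, h1, h2.trans h1.symm⟩
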